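/- Let $Y$ be a smooth scheme over a field $\mathbf{k}$ of characteristic $0$, let $\mathcal I\subset\mathcal O_Y$ be a quasi-coherent ideal sheaf, let $p\in V(\mathcal I)$, and put $\mathcal O=\mathcal O_{Y,p}$, with maximal ideal $\mathfrak m$, and $I=\mathcal I_p$. **Centers.** A *center* at $p$ is $J=(x_1^{a_1},\dots,x_k^{a_k})$ with $k\ge 0$, where $x_1,\dots,x_k$ is part of a regular system of parameters of $\mathcal O$ and $0<a_1\le\dots\le a_k$ are rational numbers. Its *invariant* is $\mathrm{inv}(J)=(a_1,\dots,a_k)$; invariants are ordered lexicographically, where a proper truncation of a sequence is larger than the sequence. Its *monomial valuation* $v_J$ is the one with $v_J(x_i)=1/a_i$: $v_J(f)$ is the largest $c$ such that $f$ lies in the ideal generated by the monomials $x_1^{m_1}\cdots x_k^{m_k}$ with $\sum_i m_i/a_i\ge c$ (and $v_J(0)=\infty$). Two centers are equal if they have the same monomial valuation. The center $J$ is *admissible* for $I$ if $v_J(f)\ge 1$ for every $f\in I$. **The center $J_I$.** For a $\mathbf{k}$-algebra $\mathcal O$ and an ideal $I\subset\mathcal O$ let $\mathcal D^a(I)$ be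 the ideal generated by all $\nabla f$ with $f\in I$ and $\nabla$ a $\mathbf{k}$-linear differential operator on $\mathcal O$ of order at most $a$, and let $\mathrm{ord}(I)=\min\{a:\mathcal D^a(I)=\mathcal O\}$ ($\infty$ if there is no such $a$). If $0<a=\mathrm{ord}(I)<\infty$, a *maximal contact element* is an $x\in\mathcal D^{a-1}(I)$ with $\mathcal D^1((x))=\mathcal O$; put $$C(I,a)=\sum_{\sum_{i=1}^a i b_i\ge a!}\ \prod_{i=1}^{a}\bigl(\mathcal D^{a-i}(I)\bigr)^{b_i},\qquad I[x]=C(I,a)\cdot\mathcal O/(x).$$ Define $J_I$ inductively: if $I=0$, then $J_I$ is the empty center ($k=0$). If $0<a_1=\mathrm{ord}(I)<\infty$, choose a maximal contact element $x_1$ and a center $J_{I[x_1]}=(\bar x_2^{b_2},\dots,\bar x_k^{b_k})$ of $I[x_1]$ on $\mathcal O/(x_1)$, constructed in the same way, and arbitrary lifts $x_i\in\mathcal O$ of $\bar x_i$, and put $J_I=(x_1^{a_1},x_2^{a_2},\dots,x_k^{a_k})$ with $a_i=b_i/(a_1-1)!$ for $i\ge2$. **Proposition.** The construction can be carried out for $I=\mathcal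 I_p$. Whatever choices are made, $J_I$ is a center at $p$, it is admissible for $I$, every center $J'$ at $p$ that is admissible for $I$ satisfies $\mathrm{inv}(J')\le\mathrm{inv}(J_I)$, and $\mathrm{inv}(J')=\mathrm{inv}(J_I)$ only if $J'=J_I$. That is, $J_I$ is the unique center of maximal invariant that is admissible for $I$. In particular $\mathrm{inv}(J_I)$ and the center $J_I$ do not depend on the choices. -/

import Mathlib

open AlgebraicGeometry CategoryTheory

open scoped NNReal ENNReal

universe u v

noncomputable section

namespace WeightedCenter

section Derivatives

variable (k : Type u) [Field k] {O : Type v} [CommRing O] [Algebra k O]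

/-- Multiplication by `r`, as a `k`-linear map. -/
def mulBy (r : O) : O →ₗ[k] O := LinearMap.mulLeft k r

/-- `k`-linear differential operators of order at most `n` on `O`, in the sense of Grothendieck:
the operators of order at most `0` are those which commute with all multiplications, and `D` has
order at most `n + 1` if all the commutators `[D, r]`, `r ∈ O`, have order at most `n`. -/
def IsDiffOp : ℕ → (O →ₗ[k] O) → Prop
  | 0, D => ∀ r : O, D ∘ₗ mulBy k r - mulBy k r ∘ₗ D = 0
  | n + 1, D => ∀ r : O, IsDiffOp n (D ∘ₗ mulBy k r - mulBy k r ∘ₗ D)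

/-- The ideal `𝒟^a(I)` generated by all `∇ f`, where `f ∈ I` and `∇` is a differential operator of
order at most `a`. -/
def derivIdeal (a : ℕ) (I : Ideal O) : Ideal O :=
  Ideal.span {g : O | ∃ D : O →ₗ[k] O, IsDiffOp k a D ∧ ∃ f ∈ I, g = D f}

/-- The order of an ideal: the least `a` with `𝒟^a(I) = O`, and `∞` if there is none. -/
def order (I : Ideal O) : ℕ∞ :=
  ⨅ (a : ℕ) (_ : derivIdeal k a I = ⊤), (a : ℕ∞)

/-- `x` is a maximal contact element for the ideal `I` of order `a`, where `0 < a < ∞`. -/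
structure IsMaximalContact (I : Ideal O) (a : ℕ) (x : O) : Prop where
  pos : 0 < a
  order_eq : order k I = a
  mem : x ∈ derivIdeal k (a - 1) I
  deriv_eq_top : derivIdeal k 1 (Ideal.span {x}) = ⊤

/-- The coefficient ideal `C(I, a)`: the sum of the products `∏_{i=1}^{a} 𝒟^{a-i}(I)^{b_i}` over
all `b` with `∑ i b_i ≥ a!`. Here `𝒟^{a-i}(I)` carries the weight `i`. -/
def coeffIdeal (I : Ideal O) (a : ℕ) : Ideal O :=
  ⨆ (b : ℕ → ℕ) (_ : a.factorial ≤ ∑ i ∈ Finset.Icc 1 a, i * b i),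
    ∏ i ∈ Finset.Icc 1 a, derivIdeal k (a - i) I ^ b i

/-- The restriction `I[x] = C(I, a)|_{V(x)}` of the coefficient ideal to the hypersurface
`V(x)`. -/
def restrictedCoeffIdeal (I : Ideal O) (a : ℕ) (x : O) : Ideal (O ⧸ Ideal.span {x}) :=
  (coeffIdeal k I a).map (Ideal.Quotient.mk (Ideal.span {x}))

end Derivatives

/-- The data `(x₁, a₁), …, (x_k, a_k)` of an expression `(x₁^{a₁}, …, x_k^{a_k})`. -/
abbrev Presentation (O : Type v) : Type v := List (O × ℚ)

/-- The expression `(x₁^{a₁}, …, x_k^{a_k})` is a center at the closed point of the local ring `O`: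
the `a_i` are positive rational numbers, `a₁ ≤ ⋯ ≤ a_k`, and `x₁, …, x_k` is part of a regular
system of parameters, which means that the `x_i` lie in the maximal ideal `𝔪` and are linearly
independent in `𝔪 / 𝔪²` (`O` will be regular). -/
structure IsCenter {O : Type v} [CommRing O] [IsLocalRing O] (J : Presentation O) : Prop where
  exponent_pos : ∀ i : Fin J.length, 0 < (J.get i).2
  exponent_mono : Monotone fun i : Fin J.length => (J.get i).2
  mem : ∀ i : Fin J.length, (J.get i).1 ∈ IsLocalRing.maximalIdeal O
  linearIndependent : LinearIndependent (IsLocalRing.ResidueField O)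
    fun i : Fin J.length => (IsLocalRing.maximalIdeal O).toCotangent ⟨(J.get i).1, mem i⟩

/-- The ideal generated by the monomials `x₁^{m₁} ⋯ x_k^{m_k}` with `∑ m_i / a_i ≥ c`. -/
def monomialIdeal {O : Type v} [CommRing O] (J : Presentation O) (c : ℝ≥0) : Ideal O :=
  Ideal.span {g : O | ∃ m : Fin J.length → ℕ,
    (c : ℝ) ≤ ∑ i, (m i : ℝ) / ((J.get i).2 : ℝ) ∧ g = ∏ i, (J.get i).1 ^ m i}

/-- The monomial valuation `v_J` of `J = (x₁^{a₁}, …, x_k^{a_k})`, for which `x_i` has the value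
`1 / a_i`: the value of `f` is the largest `c` such that `f` is a combination of monomials in the
`x_i` of value at least `c`, and `v_J(0) = ∞`. -/
def valuation {O : Type v} [CommRing O] (J : Presentation O) (f : O) : ℝ≥0∞ :=
  ⨆ (c : ℝ≥0) (_ : f ∈ monomialIdeal J c), (c : ℝ≥0∞)

/-- `J` is admissible for `I` if `v_J(f) ≥ 1` for all `f ∈ I`. -/
def IsAdmissible {O : Type v} [CommRing O] (J : Presentation O) (I : Ideal O) : Prop :=
  ∀ f ∈ I, 1 ≤ valuation J f

/-- The invariant `(a₁, …, a_k)` of `J = (x₁^{a₁}, …, x_k^{a_k})`. Invariants are ordered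
lexicographically, with a truncation of a sequence larger than the sequence; this is the
lexicographic order on infinite sequences once the finite sequences are continued by `∞`. -/
def inv {O : Type v} (J : Presentation O) : Lex (ℕ → WithTop ℚ) :=
  toLex fun n => (J[n]?).elim ⊤ fun y => (y.2 : WithTop ℚ)

/-- `IsAssociatedCenter k I J` says that `J` is a possible outcome `J_I` of the inductive
construction of the center of `I`. The zero ideal has the empty center. If `I` has order
`a` with `0 < a < ∞`, if `x` is a maximal contact element, and if `y₂, …, y_k` are
arbitrary lifts of elements `ȳ₂, …, ȳ_k` such that `(ȳ₂^{b₂}, …, ȳ_k^{b_k})` is an outcome for the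
ideal `I[x]` on `V(x)`, then `(x^a, y₂^{a₂}, …, y_k^{a_k})` with `a_i = b_i / (a - 1)!` is an
outcome for `I`. -/
inductive IsAssociatedCenter (k : Type u) [Field k] :
    ∀ {O : Type v} [CommRing O] [Algebra k O], Ideal O → Presentation O → Prop
  | zero {O : Type v} [CommRing O] [Algebra k O] :
      IsAssociatedCenter k (⊥ : Ideal O) []
  | step {O : Type v} [CommRing O] [Algebra k O] (I : Ideal O) (a : ℕ) (x : O)
      (hx : IsMaximalContact k I a x) (L : Presentation O)
      (hL : IsAssociatedCenter k (restrictedCoeffIdeal k I a x)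
        (L.map fun y => (Ideal.Quotient.mk (Ideal.span {x}) y.1, y.2))) :
      IsAssociatedCenter k I
        ((x, (a : ℚ)) :: L.map fun y => (y.1, y.2 / ((a - 1).factorial : ℚ)))

section Scheme

variable {k : Type u} [Field k] {Y : Scheme.{u}}

/-- The local ring `𝒪_{Y,p}` of a `k`-scheme `π : Y ⟶ Spec k` at a point `p`, which is regarded as
a `k`-algebra by means of `π`. -/
def LocalRing (_π : Y ⟶ Spec (CommRingCat.of k)) (p : Y) : Type u := Y.presheaf.stalk p

instance (π : Y ⟶ Spec (CommRingCat.of k)) (p : Y) : CommRing (LocalRing π p) :=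
  inferInstanceAs (CommRing (Y.presheaf.stalk p))

instance (π : Y ⟶ Spec (CommRingCat.of k)) (p : Y) : IsLocalRing (LocalRing π p) :=
  inferInstanceAs (IsLocalRing (Y.presheaf.stalk p))

instance (π : Y ⟶ Spec (CommRingCat.of k)) (p : Y) : Algebra k (LocalRing π p) :=
  RingHom.toAlgebra ((Scheme.ΓSpecIso (CommRingCat.of k)).inv ≫ π.appTop ≫
    Y.presheaf.germ ⊤ p trivial).hom

/-- The stalk `I_p ⊆ 𝒪_{Y,p}` of a quasi-coherent ideal sheaf `I`: the ideal generated by the germs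
at `p` of the sections of `I` over the affine open neighbourhoods of `p`. -/
def stalkIdeal (π : Y ⟶ Spec (CommRingCat.of k)) (p : Y) (I : Y.IdealSheafData) :
    Ideal (LocalRing π p) :=
  ⨆ (U : Y.affineOpens) (h : p ∈ U.1),
    (I.ideal U).map (show Γ(Y, U.1) →+* LocalRing π p from (Y.presheaf.germ U.1 p h).hom)

/-- The local rings of a smooth scheme over a field are formally smooth and essentially of finite type. -/
theorem localRing_smooth (π : Y ⟶ Spec (CommRingCat.of k)) [Smooth π] (p : Y) :
    Algebra.FormallySmooth k (LocalRing π p) ∧ Algebra.EssFiniteType k (LocalRing π p) := by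
  obtain ⟨_, ⟨V, hV, rfl⟩, hxV, -⟩ :=
    Y.isBasis_affineOpens.exists_subset_of_mem_open (Set.mem_univ p) isOpen_univ
  have h1 : (π.appLE ⊤ V le_top).hom.Smooth := π.smooth_appLE (isAffineOpen_top _) hV le_top
  have h2 : ((Scheme.ΓSpecIso (CommRingCat.of k)).inv ≫ π.appLE ⊤ V le_top).hom.Smooth :=
    RingHom.Smooth.respectsIso.2 _
      (Scheme.ΓSpecIso (CommRingCat.of k)).symm.commRingCatIsoToRingEquiv h1
  let : Algebra k Γ(Y, V) :=
    ((Scheme.ΓSpecIso (CommRingCat.of k)).inv ≫ π.appLE ⊤ V le_top).hom.toAlgebra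
  have : Algebra.Smooth k Γ(Y, V) := h2
  let : Algebra Γ(Y, V) (LocalRing π p) := Y.presheaf.algebra_section_stalk ⟨p, hxV⟩
  have : IsScalarTower k Γ(Y, V) (LocalRing π p) := by
    refine IsScalarTower.of_algebraMap_eq' ?_
    change ((Scheme.ΓSpecIso (CommRingCat.of k)).inv ≫ π.appTop ≫
      Y.presheaf.germ ⊤ p trivial).hom = ((((Scheme.ΓSpecIso (CommRingCat.of k)).inv ≫
        π.appLE ⊤ V le_top)) ≫ Y.presheaf.germ V p hxV).hom
    have e : π.appTop ≫ Y.presheaf.germ ⊤ p trivial =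
        π.appLE ⊤ V le_top ≫ Y.presheaf.germ V p hxV := by
      change _ = (π.appTop ≫ Y.presheaf.map (homOfLE _).op) ≫ _
      rw [Category.assoc]
      exact congrArg (π.appTop ≫ ·) (Y.presheaf.germ_res (homOfLE le_top) p hxV).symm
    rw [e, Category.assoc]
  have h3 : IsLocalization.AtPrime (LocalRing π p) (hV.primeIdealOf ⟨p, hxV⟩).asIdeal :=
    hV.isLocalization_stalk ⟨p, hxV⟩
  constructor
  · have : Algebra.FormallySmooth Γ(Y, V) (LocalRing π p) :=
      Algebra.FormallySmooth.of_isLocalization (hV.primeIdealOf ⟨p, hxV⟩).asIdeal.primeCompl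
    exact Algebra.FormallySmooth.comp k Γ(Y, V) (LocalRing π p)
  · have : Algebra.EssFiniteType Γ(Y, V) (LocalRing π p) :=
      Algebra.EssFiniteType.of_isLocalization _ (hV.primeIdealOf ⟨p, hxV⟩).asIdeal.primeCompl
    exact Algebra.EssFiniteType.comp k Γ(Y, V) (LocalRing π p)

end Scheme

end WeightedCenter

end

/-! Everything is read off the filtrations of the local ring by the ideals of monomials of weight at
least `c` in partial parameters. After clearing denominators, admissibility of `(x₁^{a₁}, …)` is an
inclusion `I ≤ weightIdeal z p D` with natural weights `p i = D / a_i` (`isAdmissible_ofFn_iff`).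
Smoothness enters only through `HasEnoughDerivations`, which passes to `O / (x)` for `x ∈ 𝔪 ∖ 𝔪²`,
so one can induct along hypersurfaces of maximal contact.

From `O` down to `V(x)`: an operator of order `j` lowers weights by at most `j p₀`, where `p₀` is
the largest weight. A center admissible for `I` has first exponent at most `a = ord I`, since
otherwise `I ⊆ 𝔪^(a+1)`. If the first exponent equals `a`, then `D = a p₀`, so `𝒟^{a-i}(I)` has
weight at least `i p₀`. Hence `C(I, a)` has weight at least `a! p₀`, and `x ∈ 𝒟^{a-1}(I)` has weight
at least `p₀`, which allows `x` to replace the first parameter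
(`IsPartialParameters.exists_replacement`). The rest of the center, with exponents multiplied by
`(a-1)!`, is then an admissible center for `I[x]`, and the comparison on `V(x)` applies to it.

From `V(x)` up to `O` (`IsMaximalContact.le_weightIdeal`): for `g ∈ 𝒟^{a-i}(I)` the power `g^{a!/i}`
lies in `C(I, a)`. The graded ring of a weight filtration is a polynomial ring over a domain, so the
filtration on `V(x)` is integrally closed and `g` restricted to `V(x)` has weight at least `i p₀`.
The remaining multiple of `x` is controlled by the operator `x ∂`, which in characteristic 0 is
invertible on multiples of `x`. Thus a weight bound for `I[x]` lifts to `I`.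

These two directions give admissibility, maximality and uniqueness together by induction.
Independence of the choices follows because any two outcomes bound each other. -/

noncomputable section

namespace WeightedCenter

/-! ### Monomial ideals of a weight filtration -/

section WeightIdeal

variable {O : Type*} [CommRing O] {ι κ A : Type*} [Fintype ι] [Fintype κ]
  [AddCommMonoid A] [PartialOrder A]

/-- The ideal generated by the monomials in the `z i` of weight at least `c`, where `z i` has the
weight `w i`. -/
def weightIdeal (z : ι → O) (w : ι → A) (c : A) : Ideal O :=
  Ideal.span {g | ∃ m : ι → ℕ, c ≤ ∑ i, m i • w i ∧ g = ∏ i, z i ^ m i}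

theorem prod_mem_weightIdeal (z : ι → O) {w : ι → A} {c : A} (m : ι → ℕ)
    (h : c ≤ ∑ i, m i • w i) : ∏ i, z i ^ m i ∈ weightIdeal z w c :=
  Ideal.subset_span ⟨m, h, rfl⟩

theorem self_mem_weightIdeal (z : ι → O) {w : ι → A} {c : A} (i : ι) (h : c ≤ w i) :
    z i ∈ weightIdeal z w c := by
  classical
  have := prod_mem_weightIdeal z (w := w) (c := c) (Pi.single i 1) (by
    rw [Finset.sum_eq_single i] <;> simp_all)
  rwa [Finset.prod_eq_single i, Pi.single_eq_same, pow_one] at this <;> simp_all [Pi.single_apply]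

theorem weightIdeal_anti (z : ι → O) (w : ι → A) : Antitone (weightIdeal z w) :=
  fun _ _ h => Ideal.span_mono fun _ ⟨m, hm, e⟩ => ⟨m, h.trans hm, e⟩

theorem weightIdeal_of_nonpos (z : ι → O) (w : ι → A) {c : A} (h : c ≤ 0) :
    weightIdeal z w c = ⊤ := by
  rw [Ideal.eq_top_iff_one]
  simpa using prod_mem_weightIdeal z (w := w) (c := c) 0 (by simpa using h)

theorem weightIdeal_mul_le [IsOrderedAddMonoid A] (z : ι → O) (w : ι → A) (c d : A) :
    weightIdeal z w c * weightIdeal z w d ≤ weightIdeal z w (c + d) := by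
  rw [weightIdeal, weightIdeal, Ideal.span_mul_span', Ideal.span_le]
  rintro _ ⟨_, ⟨m, hm, rfl⟩, _, ⟨m', hm', rfl⟩, rfl⟩
  have := prod_mem_weightIdeal z (w := w) (c := c + d) (m + m') (by
    simpa [add_smul, Finset.sum_add_distrib] using add_le_add hm hm')
  simpa [pow_add, Finset.prod_mul_distrib] using this

theorem weightIdeal_pow_le [IsOrderedAddMonoid A] (z : ι → O) (w : ι → A) (c : A) (n : ℕ) :
    weightIdeal z w c ^ n ≤ weightIdeal z w (n • c) := by
  induction n with
  | zero => simp [weightIdeal_of_nonpos]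
  | succ n ih =>
    rw [pow_succ, succ_nsmul]
    exact (Ideal.mul_mono_left ih).trans (weightIdeal_mul_le z w _ _)

/-- By multiplicativity of the filtration, two systems of weighted parameters can be compared on the
parameters alone. Every change of parameters below is justified this way. -/
theorem weightIdeal_le_of_forall_mem [IsOrderedAddMonoid A] {z : ι → O} {w : ι → A} {y : κ → O}
    {v : κ → A} (h : ∀ i, z i ∈ weightIdeal y v (w i)) (c : A) :
    weightIdeal z w c ≤ weightIdeal y v c := by
  classical
  refine Ideal.span_le.2 ?_
  rintro _ ⟨m, hm, rfl⟩
  refine weightIdeal_anti y v hm ?_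
  have (s : Finset ι) : ∏ i ∈ s, z i ^ m i ∈ weightIdeal y v (∑ i ∈ s, m i • w i) := by
    induction s using Finset.induction_on with
    | empty => simp [weightIdeal_of_nonpos]
    | insert i s hi ih =>
      rw [Finset.prod_insert hi, Finset.sum_insert hi]
      exact weightIdeal_mul_le y v _ _ (Ideal.mul_mem_mul
        (weightIdeal_pow_le y v _ _ (Ideal.pow_mem_pow (h i) _)) ih)
  exact this Finset.univ

theorem weightIdeal_comp_equiv [IsOrderedAddMonoid A] (e : κ ≃ ι) (z : ι → O) (w : ι → A) (c : A) :
    weightIdeal (z ∘ e) (w ∘ e) c = weightIdeal z w c := by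
  refine le_antisymm
    (weightIdeal_le_of_forall_mem (fun i => self_mem_weightIdeal z (w := w) (e i) le_rfl) c)
    (weightIdeal_le_of_forall_mem (fun i => ?_) c)
  have h := self_mem_weightIdeal (z ∘ e) (w := w ∘ e) (c := w i) (e.symm i)
  rw [Function.comp_apply, Function.comp_apply, Equiv.apply_symm_apply] at h
  exact h le_rfl

theorem map_weightIdeal {R : Type*} [CommRing R] (f : O →+* R) (z : ι → O) (w : ι → A) (c : A) :
    (weightIdeal z w c).map f = weightIdeal (f ∘ z) w c := by
  rw [weightIdeal, Ideal.map_span, weightIdeal]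
  congr 1
  ext g
  constructor
  · rintro ⟨_, ⟨m, hm, rfl⟩, rfl⟩
    exact ⟨m, hm, by simp⟩
  · rintro ⟨m, hm, rfl⟩
    exact ⟨_, ⟨m, hm, rfl⟩, by simp⟩

theorem weightIdeal_tail_le [IsOrderedAddMonoid A] {n : ℕ} (z : Fin (n + 1) → O)
    (w : Fin (n + 1) → A) (c : A) :
    weightIdeal (fun i : Fin n => z i.succ) (fun i => w i.succ) c ≤ weightIdeal z w c :=
  weightIdeal_le_of_forall_mem
    (fun i : Fin n => self_mem_weightIdeal z (w := w) i.succ le_rfl) c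

theorem weightIdeal_of_apply_zero_eq_zero [IsOrderedAddMonoid A] {n : ℕ} {z : Fin (n + 1) → O}
    (hz : z 0 = 0) (w : Fin (n + 1) → A) (c : A) :
    weightIdeal z w c = weightIdeal (fun i : Fin n => z i.succ) (fun i => w i.succ) c := by
  refine le_antisymm (Ideal.span_le.2 ?_) (weightIdeal_tail_le z w c)
  rintro _ ⟨m, hm, rfl⟩
  rw [Fin.prod_univ_succ, hz]
  rcases Nat.eq_zero_or_pos (m 0) with h | h
  · rw [h, pow_zero, one_mul]
    refine prod_mem_weightIdeal (fun i : Fin n => z i.succ) (fun i => m i.succ) ?_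
    rwa [Fin.sum_univ_succ, h, zero_smul, zero_add] at hm
  · rw [zero_pow h.ne', zero_mul]
    exact Ideal.zero_mem _

theorem map_mk_weightIdeal [IsOrderedAddMonoid A] {n : ℕ} (z : Fin (n + 1) → O)
    (w : Fin (n + 1) → A) (c : A) :
    (weightIdeal z w c).map (Ideal.Quotient.mk (Ideal.span {z 0})) =
      weightIdeal (fun i : Fin n => Ideal.Quotient.mk (Ideal.span {z 0}) (z i.succ))
        (fun i => w i.succ) c := by
  rw [map_weightIdeal, weightIdeal_of_apply_zero_eq_zero]
  · rfl
  · simp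

theorem exists_mem_weightIdeal_of_mk_mem {n : ℕ} {x : O} {z : Fin n → O} {w : Fin n → A} {c : A}
    {g : O} (h : Ideal.Quotient.mk (Ideal.span {x}) g ∈
      weightIdeal (fun i : Fin n => Ideal.Quotient.mk (Ideal.span {x}) (z i)) w c) :
    ∃ f ∈ weightIdeal z w c, ∃ q, g = f + x * q := by
  have h' : Ideal.Quotient.mk (Ideal.span {x}) g ∈
      (weightIdeal z w c).map (Ideal.Quotient.mk (Ideal.span {x})) := by
    rw [map_weightIdeal]; exact h
  obtain ⟨f, hf, e⟩ := (Ideal.mem_map_iff_of_surjective _ Ideal.Quotient.mk_surjective).1 h'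
  obtain ⟨q, hq⟩ := Ideal.mem_span_singleton.1 (Ideal.Quotient.eq.1 e.symm)
  exact ⟨f, hf, q, by rw [← hq]; ring⟩

theorem weightIdeal_one_eq_span {z : ι → O} {p : ι → ℕ} (hp : ∀ i, 0 < p i) :
    weightIdeal z p 1 = Ideal.span (Set.range z) := by
  refine le_antisymm (Ideal.span_le.2 ?_) (Ideal.span_le.2 ?_)
  · rintro _ ⟨m, hm, rfl⟩
    obtain ⟨i, -, hi⟩ := Finset.exists_ne_zero_of_sum_ne_zero (Nat.one_le_iff_ne_zero.1 hm)
    refine Ideal.mem_of_dvd _ (Finset.dvd_prod_of_mem _ (Finset.mem_univ i)) ?_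
    exact Ideal.pow_mem_of_mem _ (Ideal.subset_span (Set.mem_range_self i)) _
      (Nat.pos_of_ne_zero (left_ne_zero_of_smul hi))
  · rintro _ ⟨i, rfl⟩
    exact self_mem_weightIdeal z i (hp i)

theorem weightIdeal_one_weight_eq_pow (z : ι → O) (n : ℕ) :
    weightIdeal z (1 : ι → ℕ) n = Ideal.span (Set.range z) ^ n := by
  refine le_antisymm (Ideal.span_le.2 ?_) ?_
  · rintro _ ⟨m, hm, rfl⟩
    refine Ideal.pow_le_pow_right hm ?_
    rw [← Finset.prod_pow_eq_pow_sum Finset.univ]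
    refine Ideal.prod_mem_prod fun i _ => ?_
    simpa using Ideal.pow_mem_pow (Ideal.subset_span (Set.mem_range_self i)) (m i)
  · rw [← weightIdeal_one_eq_span (p := 1) (fun _ => one_pos)]
    simpa using weightIdeal_pow_le z (1 : ι → ℕ) 1 n

/-- All monomial weights lie in `(1/D)ℕ`, so a real threshold can be rounded up to the next multiple
of `1/D`. This makes induction on the weight possible. -/
theorem weightIdeal_natCast_mul {z : ι → O} {p : ι → ℕ} (D : ℕ) (hD : 0 < D) (c : ℝ) :
    weightIdeal z (fun i => (p i : ℝ) / D) c = weightIdeal z p ⌈c * D⌉₊ := by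
  unfold weightIdeal
  congr 1
  ext g
  refine exists_congr fun m => and_congr_left fun _ => ?_
  have : (∑ i, m i • ((p i : ℝ) / D)) = ((∑ i, m i • p i : ℕ) : ℝ) / D := by
    push_cast
    rw [Finset.sum_div]
    exact Finset.sum_congr rfl fun i _ => by simp [mul_div_assoc]
  rw [this, le_div_iff₀ (by exact_mod_cast hD), Nat.ceil_le]

end WeightIdeal

/-! ### Differential operators and filtrations -/

section DiffOp

variable {k : Type u} [Field k] {O : Type v} [CommRing O] [Algebra k O]

theorem IsDiffOp.succ {n : ℕ} {D : O →ₗ[k] O} (h : IsDiffOp k n D) : IsDiffOp k (n + 1) D := by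
  induction n generalizing D with
  | zero =>
    intro r
    rw [h r]
    intro s
    simp
  | succ n ih => exact fun r => ih (h r)

theorem IsDiffOp.mono {m n : ℕ} (hmn : m ≤ n) {D : O →ₗ[k] O} (h : IsDiffOp k m D) :
    IsDiffOp k n D := by
  induction hmn with
  | refl => exact h
  | step _ ih => exact ih.succ

theorem IsDiffOp.add {n : ℕ} {D E : O →ₗ[k] O} (hD : IsDiffOp k n D) (hE : IsDiffOp k n E) :
    IsDiffOp k n (D + E) := by
  induction n generalizing D E with
  | zero =>
    intro r
    have := congr_arg₂ (· + ·) (hD r) (hE r)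
    simp only [add_zero] at this
    rw [← this, LinearMap.add_comp, LinearMap.comp_add]
    abel
  | succ n ih =>
    intro r
    have := ih (hD r) (hE r)
    rw [LinearMap.add_comp, LinearMap.comp_add]
    convert this using 1
    abel

theorem IsDiffOp.mulBy_comp {n : ℕ} {D : O →ₗ[k] O} (hD : IsDiffOp k n D) (s : O) :
    IsDiffOp k n (mulBy k s ∘ₗ D) := by
  induction n generalizing D with
  | zero =>
    intro r
    ext f
    have := LinearMap.congr_fun (hD r) f
    simp [mulBy, sub_eq_zero] at this ⊢
    rw [this]; ring
  | succ n ih =>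
    intro r
    convert ih (hD r) using 1
    ext f
    simp [mulBy]
    ring

theorem IsDiffOp.derivation_comp (δ : Derivation k O O) {n : ℕ} {D : O →ₗ[k] O}
    (hD : IsDiffOp k n D) : IsDiffOp k (n + 1) ((δ : O →ₗ[k] O) ∘ₗ D) := by
  induction n generalizing D with
  | zero =>
    intro r
    convert (hD.mulBy_comp (δ r)) using 1
    ext f
    have := LinearMap.congr_fun (hD r) f
    simp [mulBy, sub_eq_zero] at this ⊢
    rw [this, δ.leibniz]; simp; ring
  | succ n ih =>
    intro r
    convert (ih (hD r)).add (hD.mulBy_comp (δ r)) using 1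
    ext f
    simp [mulBy]
    ring

theorem isDiffOp_id : IsDiffOp k 0 (LinearMap.id : O →ₗ[k] O) := fun r => by
  ext; simp

theorem isDiffOp_one_derivation (δ : Derivation k O O) : IsDiffOp k 1 (δ : O →ₗ[k] O) := by
  simpa using (isDiffOp_id (k := k) (O := O)).derivation_comp δ

theorem apply_mem_derivIdeal {n : ℕ} {D : O →ₗ[k] O} (hD : IsDiffOp k n D) {I : Ideal O} {f : O}
    (hf : f ∈ I) : D f ∈ derivIdeal k n I :=
  Ideal.subset_span ⟨D, hD, f, hf, rfl⟩

theorem le_derivIdeal (n : ℕ) (I : Ideal O) : I ≤ derivIdeal k n I := fun _ hf =>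
  apply_mem_derivIdeal (isDiffOp_id.mono (Nat.zero_le n)) hf

theorem derivIdeal_mono (I : Ideal O) : Monotone fun n => derivIdeal k n I := fun _ _ h =>
  Ideal.span_mono fun _ ⟨D, hD, f, hf, e⟩ => ⟨D, hD.mono h, f, hf, e⟩

theorem derivation_mem_derivIdeal (δ : Derivation k O O) {n : ℕ} {I : Ideal O} {f : O}
    (hf : f ∈ derivIdeal k n I) : δ f ∈ derivIdeal k (n + 1) I := by
  refine Submodule.span_induction ?_ ?_ ?_ ?_ hf
  · rintro _ ⟨D, hD, f, hf, rfl⟩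
    exact apply_mem_derivIdeal (hD.derivation_comp δ) hf
  · simp
  · intro f g _ _ hf hg
    rw [map_add]
    exact Ideal.add_mem _ hf hg
  · intro r f hf h
    rw [smul_eq_mul, δ.leibniz]
    exact Ideal.add_mem _ (Ideal.mul_mem_left _ _ h)
      (Ideal.mul_mem_right _ _ (derivIdeal_mono I n.le_succ hf))

/-- A differential operator of order at most `j` lowers a filtration whose members are generated
by products with factors in the first `p₀` steps by at most `j * p₀`. -/
theorem IsDiffOp.map_filtration {F : ℕ → Ideal O} {p₀ : ℕ} (anti : Antitone F)
    (mul : ∀ m n, F m * F n ≤ F (m + n)) (zero : F 0 = ⊤)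
    (gen : ∀ n, 0 < n → F n ≤ ⨆ s : Finset.Icc 1 p₀, F s * F (n - s)) {n : ℕ} :
    ∀ {j : ℕ} {D : O →ₗ[k] O}, IsDiffOp k j D → ∀ f ∈ F n, D f ∈ F (n - j * p₀) := by
  induction n using Nat.strong_induction_on with
  | _ n ih =>
    intro j D hD f hf
    rcases Nat.eq_zero_or_pos n with rfl | hn
    · simp [zero]
    refine Submodule.iSup_induction _ (motive := fun f => D f ∈ F (n - j * p₀)) (gen n hn hf)
      ?_ (by simp) fun f g hf hg => by rw [map_add]; exact Ideal.add_mem _ hf hg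
    rintro ⟨s, hs⟩ f hf
    rw [Finset.mem_Icc] at hs
    refine Submodule.mul_induction_on hf ?_
      fun f g hf hg => by rw [map_add]; exact Ideal.add_mem _ hf hg
    intro z hz g hg
    dsimp only at hg
    -- Both terms are covered by induction on `n`: in the first, `g` has the smaller weight `n - s`
    -- and `z` gives back `s`; in the second, the commutator has order one less, which pays for the
    -- lost `s ≤ p₀`.
    have e : D (z * g) = z * D g + (D ∘ₗ mulBy k z - mulBy k z ∘ₗ D) g := by simp [mulBy]
    rw [e]
    refine Ideal.add_mem _ ?_ ?_
    · refine anti ?_ (mul s (n - s - j * p₀) (Ideal.mul_mem_mul hz (ih _ (by omega) hD g hg)))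
      omega
    · cases j with
      | zero => rw [hD z]; simp
      | succ j =>
        refine anti ?_ (ih _ (by omega) (hD z) g hg)
        rw [Nat.succ_mul]
        omega

theorem derivIdeal_le_filtration {F : ℕ → Ideal O} {p₀ : ℕ} (anti : Antitone F)
    (mul : ∀ m n, F m * F n ≤ F (m + n)) (zero : F 0 = ⊤)
    (gen : ∀ n, 0 < n → F n ≤ ⨆ s : Finset.Icc 1 p₀, F s * F (n - s)) {n j : ℕ} {I : Ideal O}
    (hI : I ≤ F n) : derivIdeal k j I ≤ F (n - j * p₀) := by
  refine Ideal.span_le.2 ?_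
  rintro _ ⟨D, hD, f, hf, rfl⟩
  exact hD.map_filtration anti mul zero gen f (hI hf)

/-- A monomial of positive weight has a variable as a factor, and that variable has weight between 1
and `p₀`; this is the factorisation that `IsDiffOp.map_filtration` asks for. -/
theorem derivIdeal_le_weightIdeal {ι : Type*} [Fintype ι] {z : ι → O} {p : ι → ℕ} {p₀ : ℕ}
    (hp : ∀ i, 0 < p i) (hp₀ : ∀ i, p i ≤ p₀) {n j : ℕ} {I : Ideal O}
    (hI : I ≤ weightIdeal z p n) : derivIdeal k j I ≤ weightIdeal z p (n - j * p₀) := by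
  classical
  refine derivIdeal_le_filtration (weightIdeal_anti z p) (weightIdeal_mul_le z p)
    (weightIdeal_of_nonpos z p le_rfl) (fun n hn => Ideal.span_le.2 ?_) hI
  rintro _ ⟨m, hm, rfl⟩
  obtain ⟨i, -, hi⟩ := Finset.exists_ne_zero_of_sum_ne_zero (hn.trans_le hm).ne'
  have hi' : m i ≠ 0 := left_ne_zero_of_smul hi
  refine Submodule.mem_iSup_of_mem ⟨p i, Finset.mem_Icc.2 ⟨hp i, hp₀ i⟩⟩ ?_
  obtain ⟨m', rfl⟩ : ∃ m', m = m' + Pi.single i 1 := ⟨m - Pi.single i 1, by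
    ext j
    by_cases h : j = i
    · subst h; simp; omega
    · simp [h]⟩
  have e : ∏ j, z j ^ (m' + Pi.single i 1 : ι → ℕ) j = z i * ∏ j, z j ^ m' j := by
    simp [pow_add, Finset.prod_mul_distrib, Pi.single_apply, pow_ite, -mul_ite, mul_comm]
  rw [e]
  refine Ideal.mul_mem_mul (self_mem_weightIdeal z i le_rfl) (prod_mem_weightIdeal z m' ?_)
  simp [add_mul, Finset.sum_add_distrib, Pi.single_apply] at hm ⊢
  omega

theorem derivIdeal_le_pow {K I : Ideal O} {n j : ℕ} (hI : I ≤ K ^ n) :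
    derivIdeal k j I ≤ K ^ (n - j) := by
  have := derivIdeal_le_filtration (k := k) (F := fun n => K ^ n) (p₀ := 1) (j := j)
    (fun _ _ h => Ideal.pow_le_pow_right h) (fun m n => (pow_add K m n).ge) (by simp)
    (fun n hn => ?_) hI
  · simpa using this
  · refine le_trans ?_ (le_iSup _ ⟨1, by simp⟩)
    simp only [pow_one]
    rw [← pow_succ', Nat.sub_add_cancel hn]

end DiffOp

theorem sum_smul_derivation_apply {k O ι : Type*} [Field k] [CommRing O] [Algebra k O]
    [Fintype ι] (c : ι → O) (δ : ι → Derivation k O O) (f : O) :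
    (∑ i, c i • δ i) f = ∑ i, c i * δ i f := by
  exact map_sum ((Pi.evalAddMonoidHom (fun _ : O => O) f).comp Derivation.coeFnAddMonoidHom)
    (fun i => c i • δ i) Finset.univ

theorem isUnit_natCast {k O : Type*} [Field k] [CharZero k] [CommRing O] [Algebra k O] {n : ℕ}
    (hn : n ≠ 0) : IsUnit (n : O) := by
  have := (IsUnit.mk0 (n : k) (Nat.cast_ne_zero.2 hn)).map (algebraMap k O)
  simpa using this

/-! ### Partial parameters and dual derivations -/

section Parameters

open IsLocalRing

/-- The elements `z i` of the maximal ideal are linearly independent modulo its square. -/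
structure IsPartialParameters {O ι : Type*} [CommRing O] [IsLocalRing O] [Fintype ι] (z : ι → O) :
    Prop where
  mem : ∀ i, z i ∈ maximalIdeal O
  coeff_mem : ∀ c : ι → O, ∑ i, c i * z i ∈ maximalIdeal O ^ 2 → ∀ i, c i ∈ maximalIdeal O

/-- A noetherian local `k`-algebra with enough derivations: each element of `𝔪 ∖ 𝔪²` has a unit
as one of its derivatives. -/
structure HasEnoughDerivations (k : Type*) [Field k] (O : Type*) [CommRing O] [Algebra k O]
    [IsLocalRing O] : Prop where
  isNoetherianRing : IsNoetherianRing O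
  exists_isUnit : ∀ x ∈ maximalIdeal O, x ∉ maximalIdeal O ^ 2 →
    ∃ δ : Derivation k O O, IsUnit (δ x)

variable {k O : Type*} [Field k] [CommRing O] [Algebra k O] [IsLocalRing O]

theorem mul_mem_maximalIdeal_sq_iff {x c : O} (hx : x ∉ maximalIdeal O ^ 2)
    (h : c * x ∈ maximalIdeal O ^ 2) : c ∈ maximalIdeal O := by
  by_contra hc
  exact hx ((Ideal.unit_mul_mem_iff_mem _ (notMem_maximalIdeal.1 hc)).1 h)

theorem IsPartialParameters.notMem_sq {ι : Type*} [Fintype ι] {z : ι → O}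
    (hz : IsPartialParameters z) (i : ι) : z i ∉ maximalIdeal O ^ 2 := by
  classical
  intro h
  have := hz.coeff_mem (Pi.single i 1) (by simpa [Pi.single_apply] using h) i
  exact (Ideal.ne_top_iff_one _).1 (maximalIdeal.isMaximal O).ne_top (by simp at this)

theorem IsPartialParameters.cons_iff {n : ℕ} {x : O} {z : Fin n → O} :
    IsPartialParameters (Fin.cons x z : Fin (n + 1) → O) ↔
      x ∈ maximalIdeal O ∧ (∀ i, z i ∈ maximalIdeal O) ∧
      ∀ (d : O) (c : Fin n → O), d * x + ∑ i, c i * z i ∈ maximalIdeal O ^ 2 →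
        d ∈ maximalIdeal O ∧ ∀ i, c i ∈ maximalIdeal O := by
  constructor
  · intro h
    refine ⟨h.mem 0, fun i => h.mem i.succ, fun d c hc => ?_⟩
    have := h.coeff_mem (Fin.cons d c) (by simpa [Fin.sum_univ_succ] using hc)
    exact ⟨this 0, fun i => this i.succ⟩
  · rintro ⟨h0, h1, h2⟩
    refine ⟨Fin.cases h0 h1, fun c hc => ?_⟩
    have := h2 (c 0) (fun i => c i.succ) (by simpa [Fin.sum_univ_succ] using hc)
    exact Fin.cases this.1 this.2

theorem IsPartialParameters.tail {n : ℕ} {z : Fin (n + 1) → O} (hz : IsPartialParameters z) :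
    IsPartialParameters fun i : Fin n => z i.succ := by
  refine ⟨fun i => hz.mem i.succ, fun c hc i => ?_⟩
  exact hz.coeff_mem (Fin.cons 0 c) (by simpa [Fin.sum_univ_succ] using hc) i.succ

/-- Gram–Schmidt: given `δ` dual to the tail, subtract from `z 0` its components `δ i (z 0) * z
i.succ`. The result is still outside `𝔪²`, so some `ε` sends it to a unit. Correcting `ε` by the `δ
i` makes it vanish on the tail and changes its value on `z 0` only within the units; then `ε` is
normalised and the `δ i` are corrected. -/
theorem HasEnoughDerivations.exists_dual (hO : HasEnoughDerivations k O) {n : ℕ} {z : Fin n → O}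
    (hz : IsPartialParameters z) :
    ∃ δ : Fin n → Derivation k O O, ∀ i j, δ i (z j) = if i = j then 1 else 0 := by
  induction n with
  | zero => exact ⟨0, fun i => i.elim0⟩
  | succ n ih =>
    obtain ⟨δ, hδ⟩ := ih hz.tail
    obtain ⟨ε, hε⟩ := hO.exists_isUnit (z 0 - ∑ i, δ i (z 0) * z i.succ)
      (Ideal.sub_mem _ (hz.mem 0) (Ideal.sum_mem _ fun i _ => Ideal.mul_mem_left _ _ (hz.mem _)))
      fun h => by
        have := hz.coeff_mem (Fin.cons 1 fun i => - δ i (z 0)) (by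
          simpa [Fin.sum_univ_succ, sub_eq_add_neg] using h) 0
        exact (Ideal.ne_top_iff_one _).1 (maximalIdeal.isMaximal O).ne_top (by simp at this)
    let ε' : Derivation k O O := ε - ∑ i, ε (z i.succ) • δ i
    have e' (f : O) : ε' f = ε f - ∑ i, ε (z i.succ) * δ i f := by
      simp [ε', sum_smul_derivation_apply]
    have h1 (j : Fin n) : ε' (z j.succ) = 0 := by simp [e', hδ]
    have h2 : IsUnit (ε' (z 0)) := by
      have : ε' (z 0) = ε (z 0 - ∑ i, δ i (z 0) * z i.succ) + ∑ i, z i.succ * ε (δ i (z 0)) := by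
        simp only [e', map_sub, map_sum, Derivation.leibniz, smul_eq_mul, Finset.sum_add_distrib]
        simp only [mul_comm (δ _ (z 0))]
        ring
      rw [this]
      by_contra h
      have hm : ∑ i, z i.succ * ε (δ i (z 0)) ∈ maximalIdeal O :=
        Ideal.sum_mem _ fun i _ => Ideal.mul_mem_right _ _ (hz.mem _)
      rw [← mem_nonunits_iff, ← mem_maximalIdeal, Ideal.add_mem_iff_left _ hm] at h
      exact h hε
    obtain ⟨u, hu⟩ := h2
    refine ⟨Fin.cons ((↑u⁻¹ : O) • ε') fun i => δ i - (δ i (z 0) * (↑u⁻¹ : O)) • ε', ?_⟩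
    intro i j
    refine Fin.cases ?_ (fun i => ?_) i <;> refine Fin.cases ?_ (fun j => ?_) j
    · simp [← hu]
    · simp [h1, (Fin.succ_ne_zero j).symm]
    · simp [← hu, Fin.succ_ne_zero]
    · simp [h1, hδ]

/-- A generating family of `𝔪` of least size works: a relation modulo `𝔪²` with a unit coefficient
would make one generator superfluous, by Nakayama. -/
theorem exists_parameters [IsNoetherianRing O] :
    ∃ (n : ℕ) (z : Fin n → O), IsPartialParameters z ∧
      Ideal.span (Set.range z) = maximalIdeal O := by
  classical
  have hex : ∃ (n : ℕ) (z : Fin n → O), Ideal.span (Set.range z) = maximalIdeal O := by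
    obtain ⟨n, z, h⟩ := Submodule.fg_iff_exists_fin_generating_family.1
      (IsNoetherian.noetherian (maximalIdeal O))
    exact ⟨n, z, h⟩
  obtain ⟨z, hz⟩ := Nat.find_spec hex
  have hmin := fun m => Nat.find_min hex (m := m)
  generalize Nat.find hex = n at z hz hmin
  have hmem (i : Fin n) : z i ∈ maximalIdeal O := hz ▸ Ideal.subset_span ⟨i, rfl⟩
  refine ⟨n, z, ⟨hmem, fun c hc i => ?_⟩, hz⟩
  by_contra hi
  obtain _ | n := n
  · exact i.elim0
  obtain ⟨u, hu⟩ := notMem_maximalIdeal.1 hi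
  set N := Ideal.span (Set.range fun j : Fin n => z (i.succAbove j)) with hN
  refine hmin n n.lt_succ_self ⟨fun j => z (i.succAbove j), le_antisymm (Ideal.span_le.2 ?_) ?_⟩
  · rintro _ ⟨j, rfl⟩
    exact hmem _
  refine Submodule.le_of_le_smul_of_le_jacobson_bot (I := maximalIdeal O)
    (IsNoetherian.noetherian _) (maximalIdeal_le_jacobson _) ?_
  rw [smul_eq_mul, ← pow_two]
  conv_lhs => rw [← hz]
  refine Ideal.span_le.2 ?_
  have hj (j : Fin n) : z (i.succAbove j) ∈ N := Ideal.subset_span ⟨j, rfl⟩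
  rintro _ ⟨j, rfl⟩
  rcases Fin.eq_self_or_eq_succAbove i j with rfl | ⟨j, rfl⟩
  · have e : z j = (↑u⁻¹ : O) * (∑ i, c i * z i) -
        (↑u⁻¹ : O) * ∑ l, c (j.succAbove l) * z (j.succAbove l) := by
      rw [Fin.sum_univ_succAbove _ j, ← hu]
      ring_nf
      simp
    rw [e]
    refine Ideal.sub_mem _ (Ideal.mul_mem_left _ _ (Ideal.mem_sup_right hc))
      (Ideal.mul_mem_left _ _ (Ideal.mem_sup_left ?_))
    exact Ideal.sum_mem _ fun l _ => Ideal.mul_mem_left _ _ (hj l)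
  · exact Ideal.mem_sup_left (hj j)

/-- The Euler derivation `θ = ∑ z i • δ i` acts on `𝔪^t / 𝔪^(t+1)` as multiplication by `t`. If `f ∈
𝔪^(t+1)` with `t < s`, then `θ f ∈ 𝔪^(t+2)`, and dividing by `t + 1` gives `f ∈ 𝔪^(t+2)`. -/
theorem HasEnoughDerivations.mem_pow_of_forall_derivation_mem [CharZero k]
    (hO : HasEnoughDerivations k O) {f : O} (hf : f ∈ maximalIdeal O) {s : ℕ}
    (h : ∀ δ : Derivation k O O, δ f ∈ maximalIdeal O ^ s) : f ∈ maximalIdeal O ^ (s + 1) := by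
  have := hO.isNoetherianRing
  obtain ⟨n, z, hz, hspan⟩ := exists_parameters (O := O)
  obtain ⟨δ, hδ⟩ := hO.exists_dual hz
  let θ : Derivation k O O := ∑ i, z i • δ i
  have hθ (f : O) : θ f = ∑ i, z i * δ i f := by simp [θ, sum_smul_derivation_apply]
  have hz' (i : Fin n) : θ (z i) = z i := by simp [hθ, hδ]
  have hm (f : O) : θ f ∈ maximalIdeal O := by
    rw [hθ]
    exact Ideal.sum_mem _ fun i _ => Ideal.mul_mem_right _ _ (hz.mem i)
  have h1 : ∀ g ∈ maximalIdeal O, θ g - g ∈ maximalIdeal O ^ 2 := by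
    intro g hg
    rw [← hspan] at hg
    refine Submodule.span_induction ?_ (by simp) ?_ ?_ hg
    · rintro _ ⟨i, rfl⟩
      simp [hz']
    · intro a b _ _ ha hb
      have : θ (a + b) - (a + b) = (θ a - a) + (θ b - b) := by rw [map_add]; ring
      rw [this]
      exact Ideal.add_mem _ ha hb
    · intro r a ha h
      have : θ (r • a) - r • a = r * (θ a - a) + θ r * a := by
        rw [smul_eq_mul, θ.leibniz]; simp; ring
      rw [this, pow_two]
      replace ha : a ∈ maximalIdeal O := hspan ▸ ha
      exact Ideal.add_mem _ (Ideal.mul_mem_left _ _ (pow_two (maximalIdeal O) ▸ h))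
        (Ideal.mul_mem_mul (hm r) ha)
  have h2 (t : ℕ) : ∀ g ∈ maximalIdeal O ^ t, θ g - t * g ∈ maximalIdeal O ^ (t + 1) := by
    induction t with
    | zero => intro g _; simpa using hm g
    | succ t ih =>
      intro g hg
      rw [pow_succ] at hg
      refine Submodule.mul_induction_on hg ?_ ?_
      · intro a ha b hb
        have : θ (a * b) - (t + 1 : ℕ) * (a * b) = (θ a - t * a) * b + a * (θ b - b) := by
          rw [θ.leibniz]; simp; ring
        rw [this]
        refine Ideal.add_mem _ ?_ ?_
        · rw [pow_succ _ (t + 1)]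
          exact Ideal.mul_mem_mul (ih a ha) hb
        · have : t + 1 + 1 = t + 2 := rfl
          rw [this, pow_add]
          exact Ideal.mul_mem_mul ha (h1 b hb)
      · intro a b ha hb
        have : θ (a + b) - (t + 1 : ℕ) * (a + b) =
            (θ a - (t + 1 : ℕ) * a) + (θ b - (t + 1 : ℕ) * b) := by rw [map_add]; ring
        rw [this]
        exact Ideal.add_mem _ ha hb
  have h3 (t : ℕ) (ht : t ≤ s) : f ∈ maximalIdeal O ^ (t + 1) := by
    induction t with
    | zero => simpa using hf
    | succ t ih =>
      have hf' := ih (by omega)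
      have h4 := h2 _ f hf'
      have h5 : θ f ∈ maximalIdeal O ^ (t + 1 + 1) := by
        rw [hθ, pow_succ']
        exact Ideal.sum_mem _ fun i _ => Ideal.mul_mem_mul (hz.mem i)
          (Ideal.pow_le_pow_right ht (h (δ i)))
      have h6 : ((t + 1 : ℕ) : O) * f ∈ maximalIdeal O ^ (t + 1 + 1) := by
        simpa using Ideal.sub_mem _ h5 h4
      exact (Ideal.unit_mul_mem_iff_mem _ (isUnit_natCast (k := k) t.succ_ne_zero)).1 h6
  exact h3 s le_rfl

end Parameters

/-! ### Restriction to the zero locus of partial parameters -/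

section Quotient

open IsLocalRing

variable {k O : Type*} [Field k] [CommRing O] [Algebra k O] [IsLocalRing O]

theorem isLocalRing_quotient {K : Ideal O} (hK : K ≤ maximalIdeal O) : IsLocalRing (O ⧸ K) := by
  have : Nontrivial (O ⧸ K) := Ideal.Quotient.nontrivial_iff.2
    (ne_top_of_le_ne_top (maximalIdeal.isMaximal O).ne_top hK)
  exact IsLocalRing.of_surjective' (Ideal.Quotient.mk K) Ideal.Quotient.mk_surjective

variable {K : Ideal O} [IsLocalRing (O ⧸ K)]

theorem mk_mem_maximalIdeal_iff {f : O} :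
    Ideal.Quotient.mk K f ∈ maximalIdeal (O ⧸ K) ↔ f ∈ maximalIdeal O := by
  have : IsLocalHom (Ideal.Quotient.mk K) :=
    IsLocalHom.of_surjective _ Ideal.Quotient.mk_surjective
  rw [mem_maximalIdeal, mem_maximalIdeal, mem_nonunits_iff, mem_nonunits_iff, isUnit_map_iff]

theorem map_mk_maximalIdeal :
    (maximalIdeal O).map (Ideal.Quotient.mk K) = maximalIdeal (O ⧸ K) := by
  have : maximalIdeal O = (maximalIdeal (O ⧸ K)).comap (Ideal.Quotient.mk K) := by
    ext f
    rw [Ideal.mem_comap, mk_mem_maximalIdeal_iff]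
  rw [this, Ideal.map_comap_of_surjective _ Ideal.Quotient.mk_surjective]

theorem mk_mem_maximalIdeal_pow_iff {f : O} {n : ℕ} :
    Ideal.Quotient.mk K f ∈ maximalIdeal (O ⧸ K) ^ n ↔ f ∈ maximalIdeal O ^ n ⊔ K := by
  rw [← map_mk_maximalIdeal, ← Ideal.map_pow, Ideal.mem_quotient_iff_mem_sup]

/-- A lift `f` of an element outside the square of the maximal ideal of `O ⧸ K` extends `z` to a
longer system of partial parameters. The derivation dual to `f` kills all `z i`, hence preserves
`K`, and descends to a derivation with value 1. -/
theorem HasEnoughDerivations.quotient (hO : HasEnoughDerivations k O) {n : ℕ} {z : Fin n → O}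
    (hz : IsPartialParameters z) (hK : K = Ideal.span (Set.range z)) :
    HasEnoughDerivations k (O ⧸ K) := by
  have := hO.isNoetherianRing
  refine ⟨inferInstance, fun f hf hf2 => ?_⟩
  obtain ⟨f, rfl⟩ := Ideal.Quotient.mk_surjective f
  rw [mk_mem_maximalIdeal_iff] at hf
  rw [mk_mem_maximalIdeal_pow_iff] at hf2
  have hp : IsPartialParameters (Fin.cons f z : Fin (n + 1) → O) := by
    rw [IsPartialParameters.cons_iff]
    refine ⟨hf, hz.mem, fun d c h => ?_⟩
    have hd : d ∈ maximalIdeal O := by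
      by_contra hd
      refine hf2 ((Ideal.unit_mul_mem_iff_mem _ (notMem_maximalIdeal.1 hd)).1 ?_)
      rw [← add_sub_cancel_right (d * f) (∑ i, c i * z i)]
      refine Ideal.sub_mem _ (Ideal.mem_sup_left h) (Ideal.mem_sup_right ?_)
      rw [hK]
      exact Ideal.sum_mem _ fun i _ => Ideal.mul_mem_left _ _
        (Ideal.subset_span (Set.mem_range_self i))
    refine ⟨hd, hz.coeff_mem c ?_⟩
    rw [← add_sub_cancel_left (d * f) (∑ i, c i * z i)]
    refine Ideal.sub_mem _ h ?_
    rw [pow_two]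
    exact Ideal.mul_mem_mul hd hf
  obtain ⟨δ, hδ⟩ := hO.exists_dual hp
  have hδK : ∀ g, Ideal.Quotient.mkₐ k K g = 0 → Ideal.Quotient.mkₐ k K (δ 0 g) = 0 := by
    intro g hg
    simp only [Ideal.Quotient.mkₐ_eq_mk, Ideal.Quotient.eq_zero_iff_mem] at hg ⊢
    rw [hK] at hg
    refine Submodule.span_induction ?_ (by simp) ?_ ?_ hg
    · rintro _ ⟨i, rfl⟩
      have := hδ 0 i.succ
      rw [Fin.cons_succ] at this
      simp [this, (Fin.succ_ne_zero i).symm]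
    · intro a b _ _ ha hb
      rw [map_add]
      exact Ideal.add_mem _ ha hb
    · intro r a ha h
      rw [smul_eq_mul, Derivation.leibniz]
      exact Ideal.add_mem _ (Ideal.mul_mem_left _ _ h) (Ideal.mul_mem_right _ _ (hK ▸ ha))
  refine ⟨Derivation.liftOfSurjective (Ideal.Quotient.mkₐ_surjective k K) hδK, ?_⟩
  have e := Derivation.liftOfSurjective_apply (Ideal.Quotient.mkₐ_surjective k K) hδK f
  have h0 := hδ 0 0
  rw [Fin.cons_zero] at h0
  rw [Ideal.Quotient.mkₐ_eq_mk] at e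
  rw [e, h0]
  simp

theorem IsPartialParameters.quotient {n : ℕ} {x : O} {z : Fin n → O}
    [IsLocalRing (O ⧸ Ideal.span {x})]
    (hz : IsPartialParameters (Fin.cons x z : Fin (n + 1) → O)) :
    IsPartialParameters fun i => Ideal.Quotient.mk (Ideal.span {x}) (z i) := by
  rw [cons_iff] at hz
  refine ⟨fun i => mk_mem_maximalIdeal_iff.2 (hz.2.1 i), fun c hc i => ?_⟩
  choose c' hc' using fun i => Ideal.Quotient.mk_surjective (c i)
  simp only [← hc', ← map_mul, ← map_sum, mk_mem_maximalIdeal_pow_iff] at hc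
  obtain ⟨a, ha, b, hb, e⟩ := Submodule.mem_sup.1 hc
  obtain ⟨q, rfl⟩ := Ideal.mem_span_singleton.1 hb
  rw [← hc', mk_mem_maximalIdeal_iff]
  refine (hz.2.2 (-q) c' ?_).2 i
  rw [← e]
  convert ha using 1
  ring

theorem IsPartialParameters.cons_of_quotient {n : ℕ} {x : O} {z : Fin n → O}
    [IsLocalRing (O ⧸ Ideal.span {x})] (hx : x ∈ maximalIdeal O) (hx2 : x ∉ maximalIdeal O ^ 2)
    (hz : IsPartialParameters fun i => Ideal.Quotient.mk (Ideal.span {x}) (z i)) :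
    IsPartialParameters (Fin.cons x z : Fin (n + 1) → O) := by
  rw [cons_iff]
  have hz' (i) : z i ∈ maximalIdeal O := mk_mem_maximalIdeal_iff.1 (hz.mem i)
  refine ⟨hx, hz', fun d c h => ?_⟩
  have hc (i) : c i ∈ maximalIdeal O := by
    refine mk_mem_maximalIdeal_iff.1
      (hz.coeff_mem (fun i => Ideal.Quotient.mk (Ideal.span {x}) (c i)) ?_ i)
    simp only [← map_mul, ← map_sum, mk_mem_maximalIdeal_pow_iff]
    rw [← add_sub_cancel_left (d * x) (∑ i, c i * z i)]
    exact Ideal.sub_mem _ (Ideal.mem_sup_left h)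
      (Ideal.mem_sup_right (Ideal.mul_mem_left _ _ (Ideal.mem_span_singleton_self x)))
  refine ⟨mul_mem_maximalIdeal_sq_iff hx2 ?_, hc⟩
  rw [← add_sub_cancel_right (d * x) (∑ i, c i * z i)]
  refine Ideal.sub_mem _ h (Ideal.sum_mem _ fun i _ => ?_)
  rw [pow_two]
  exact Ideal.mul_mem_mul (hc i) (hz' i)

theorem IsPartialParameters.of_notMem_sq {x : O} (hx : x ∈ maximalIdeal O)
    (hx2 : x ∉ maximalIdeal O ^ 2) : IsPartialParameters fun _ : Fin 1 => x :=
  ⟨fun _ => hx, fun c hc i => by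
    rw [Subsingleton.elim i 0]
    exact mul_mem_maximalIdeal_sq_iff hx2 (by simpa using hc)⟩

theorem HasEnoughDerivations.quotient_span_singleton (hO : HasEnoughDerivations k O) {x : O}
    [IsLocalRing (O ⧸ Ideal.span {x})] (hx : x ∈ maximalIdeal O) (hx2 : x ∉ maximalIdeal O ^ 2) :
    HasEnoughDerivations k (O ⧸ Ideal.span {x}) :=
  hO.quotient (.of_notMem_sq hx hx2) (by rw [Set.range_const])

end Quotient

/-! ### The graded ring of a weight filtration -/

section Graded

open IsLocalRing MvPolynomial

variable {k O : Type*} [Field k] [CommRing O] [Algebra k O]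

theorem derivation_aeval {n : ℕ} {z : Fin n → O} {δ : Derivation k O O} {i : Fin n}
    (hδ : ∀ j, δ (z j) = if i = j then 1 else 0) (G : MvPolynomial (Fin n) k) :
    δ (aeval z G) = aeval z (pderiv i G) := by
  induction G using MvPolynomial.induction_on with
  | C a => simp
  | add p q hp hq => simp [hp, hq]
  | mul_X p j hp => simp [hp, hδ, Pi.single_apply, Derivation.leibniz, eq_comm, apply_ite (aeval z)]

theorem derivation_prod_pow {n : ℕ} {z : Fin n → O} {δ : Derivation k O O} {i : Fin n}
    (hδ : ∀ j, δ (z j) = if i = j then 1 else 0) (m : Fin n →₀ ℕ) :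
    δ (∏ j, z j ^ m j) = m i * ∏ j, z j ^ (m - Finsupp.single i 1 : Fin n →₀ ℕ) j := by
  have := derivation_aeval hδ (monomial m 1)
  rw [pderiv_monomial, aeval_monomial, aeval_monomial, Finsupp.prod_fintype _ _ (by simp),
    Finsupp.prod_fintype _ _ (by simp)] at this
  simpa using this

theorem weight_eq_sum {n : ℕ} (p : Fin n → ℕ) (m : Fin n →₀ ℕ) :
    Finsupp.weight p m = ∑ i, m i • p i := by
  rw [Finsupp.weight_apply, Finsupp.sum_fintype _ _ (by simp)]

theorem derivation_mem_weightIdeal {n : ℕ} {z : Fin n → O} {δ : Derivation k O O} {i : Fin n}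
    (hδ : ∀ j, δ (z j) = if i = j then 1 else 0) (p : Fin n → ℕ) {N : ℕ} {f : O}
    (hf : f ∈ weightIdeal z p N) : δ f ∈ weightIdeal z p (N - p i) := by
  refine Submodule.span_induction ?_ (by simp) ?_ ?_ hf
  · rintro _ ⟨m, hm, rfl⟩
    have e := derivation_prod_pow hδ (Finsupp.equivFunOnFinite.symm m)
    simp only [Finsupp.equivFunOnFinite_symm_apply_apply] at e
    rw [e]
    rcases Nat.eq_zero_or_pos (m i) with h | h
    · simp [h]
    refine Ideal.mul_mem_left _ _ (prod_mem_weightIdeal z _ ?_)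
    obtain ⟨d, hd⟩ : ∃ d, Finsupp.equivFunOnFinite.symm m = d + Finsupp.single i 1 :=
      ⟨_, (Finsupp.sub_add_single_one_cancel (by simpa using h.ne')).symm⟩
    have hm' : N ≤ Finsupp.weight p (Finsupp.equivFunOnFinite.symm m) := by
      rw [weight_eq_sum]; exact hm
    rw [hd, map_add, Finsupp.weight_single] at hm'
    rw [hd, ← weight_eq_sum, add_tsub_cancel_right]
    simp at hm'
    omega
  · intro a b _ _ ha hb
    rw [map_add]
    exact Ideal.add_mem _ ha hb
  · intro r a ha h
    rw [smul_eq_mul, Derivation.leibniz]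
    exact Ideal.add_mem _ (Ideal.mul_mem_left _ _ h)
      (Ideal.mul_mem_right _ _ (weightIdeal_anti z p (Nat.sub_le _ _) ha))

theorem eval_mem_weightIdeal {n : ℕ} (z : Fin n → O) {p : Fin n → ℕ} {N e : ℕ}
    {F : MvPolynomial (Fin n) O} (hF : F.IsWeightedHomogeneous p N)
    (h : ∀ d, coeff d F ∈ weightIdeal z p e) : eval z F ∈ weightIdeal z p (e + N) := by
  rw [eval_eq']
  refine Ideal.sum_mem _ fun d hd => weightIdeal_mul_le z p _ _ (Ideal.mul_mem_mul (h d) ?_)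
  exact prod_mem_weightIdeal z d (by rw [← weight_eq_sum, hF (mem_support_iff.1 hd)])

/-- The error comes from differentiating the coefficients, which leaves the monomials and their
weight `N` untouched, whereas `pderiv i` lowers the weight to `N - p i`. -/
theorem derivation_eval_sub_mem {n : ℕ} {z : Fin n → O} {δ : Derivation k O O} {i : Fin n}
    (hδ : ∀ j, δ (z j) = if i = j then 1 else 0) {p : Fin n → ℕ} {N : ℕ}
    {F : MvPolynomial (Fin n) O} (hF : F.IsWeightedHomogeneous p N) :
    δ (eval z F) - eval z (pderiv i F) ∈ weightIdeal z p N := by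
  induction hF using IsWeightedHomogeneous.induction_on with
  | zero => simp
  | add P Q hP hQ h h' =>
    simp only [map_add]
    convert Ideal.add_mem _ h h' using 1
    ring
  | monomial d r hr =>
    have e := derivation_prod_pow hδ d
    rw [pderiv_monomial, eval_monomial, eval_monomial, Finsupp.prod_fintype _ _ (by simp),
      Finsupp.prod_fintype _ _ (by simp), δ.leibniz, e]
    have hm : ∏ j, z j ^ d j ∈ weightIdeal z p N :=
      prod_mem_weightIdeal z d (by rw [← weight_eq_sum, hr])
    convert Ideal.mul_mem_right (δ r) _ hm using 1
    simp
    ring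

theorem exists_isWeightedHomogeneous {n : ℕ} {z : Fin n → O} {p : Fin n → ℕ} {N : ℕ} {f : O}
    (hf : f ∈ weightIdeal z p N) : ∃ F : MvPolynomial (Fin n) O,
      F.IsWeightedHomogeneous p N ∧ f - eval z F ∈ weightIdeal z p (N + 1) := by
  refine Submodule.span_induction ?_ ?_ ?_ ?_ hf
  · rintro _ ⟨m, hm, rfl⟩
    rcases hm.eq_or_lt with h | h
    · refine ⟨monomial (Finsupp.equivFunOnFinite.symm m) 1,
        isWeightedHomogeneous_monomial _ _ _ ?_, ?_⟩
      · rw [weight_eq_sum]; exact h.symm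
      · rw [eval_monomial, Finsupp.prod_fintype _ _ (by simp)]
        simp
    · exact ⟨0, isWeightedHomogeneous_zero _ _ _, by simpa using prod_mem_weightIdeal z m h⟩
  · exact ⟨0, isWeightedHomogeneous_zero _ _ _, by simp⟩
  · rintro a b _ _ ⟨F, hF, h⟩ ⟨G, hG, h'⟩
    refine ⟨F + G, hF.add hG, ?_⟩
    convert Ideal.add_mem _ h h' using 1
    simp
    ring
  · rintro r a _ ⟨F, hF, h⟩
    refine ⟨C r * F, hF.C_mul r, ?_⟩
    convert Ideal.mul_mem_left _ r h using 1
    simp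
    ring

variable [IsLocalRing O] [CharZero k]

/-- The associated graded ring of the filtration by weights is a polynomial ring. -/
theorem coeff_mem_of_eval_mem (hO : HasEnoughDerivations k O) {n : ℕ} {z : Fin n → O}
    (hz : IsPartialParameters z) {p : Fin n → ℕ} (hp : ∀ i, 0 < p i) {N : ℕ}
    {F : MvPolynomial (Fin n) O} (hF : F.IsWeightedHomogeneous p N)
    (h : eval z F ∈ weightIdeal z p (N + 1)) (d : Fin n →₀ ℕ) :
    coeff d F ∈ weightIdeal z p 1 := by
  obtain ⟨δ, hδ⟩ := hO.exists_dual hz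
  induction N using Nat.strong_induction_on generalizing F d with
  | _ N ih =>
    by_cases hd : coeff d F = 0
    · simp [hd]
    by_cases h0 : d = 0
    · subst h0
      obtain rfl : N = 0 := by simpa using (hF hd).symm
      have : F = C (coeff 0 F) := by
        ext d'
        rw [coeff_C]
        split_ifs with h'
        · rw [h']
        by_contra h''
        obtain ⟨i, hi⟩ := Finsupp.ne_iff.1 (Ne.symm h')
        have hw := hF h''
        rw [weight_eq_sum, Finset.sum_eq_zero_iff] at hw
        have := hw i (Finset.mem_univ i)
        simp at this hi
        rcases this with h1 | h1
        · exact hi h1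
        · exact (hp i).ne' h1
      rw [this, eval_C] at h
      simpa using h
    · obtain ⟨i, hi⟩ := Finsupp.ne_iff.1 h0
      obtain ⟨d', rfl⟩ : ∃ d', d = d' + Finsupp.single i 1 :=
        ⟨_, (Finsupp.sub_add_single_one_cancel hi).symm⟩
      have hN : Finsupp.weight p d' + p i = N := by
        rw [← hF hd, map_add, Finsupp.weight_single, one_smul]
      have hpi := hp i
      -- Applying `δ i` yields the hypothesis for `pderiv i F`, of weight `N - p i`; the error term
      -- of weight `N` is harmless because `p i ≥ 1`. The coefficient of `pderiv i F` at `d'` is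
      -- that of `F` times `d' i + 1`, a unit in characteristic 0.
      have h1 := derivation_mem_weightIdeal (hδ i) p h
      have h2 := weightIdeal_anti z p (by omega : N + 1 - p i ≤ N)
        (derivation_eval_sub_mem (hδ i) hF)
      have h3 := Ideal.sub_mem _ h1 h2
      rw [sub_sub_cancel] at h3
      have h4 := ih (N - p i) (by omega) (hF.pderiv (by omega))
        (weightIdeal_anti z p (by omega) h3) d'
      rw [coeff_pderiv, mul_comm] at h4
      refine (Ideal.unit_mul_mem_iff_mem _ ?_).1 h4
      exact_mod_cast isUnit_natCast (k := k) (O := O) (d' i).succ_ne_zero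

/-- The leading forms of `f` and `g` are nonzero polynomials over the domain `O / (z)`, so their
product is nonzero; by `coeff_mem_of_eval_mem` it would vanish if `f * g` had larger weight. -/
theorem mul_notMem_weightIdeal (hO : HasEnoughDerivations k O) {n : ℕ} {z : Fin n → O}
    (hz : IsPartialParameters z) (hP : (Ideal.span (Set.range z)).IsPrime) {p : Fin n → ℕ}
    (hp : ∀ i, 0 < p i) {s t : ℕ} {f g : O} (hf : f ∈ weightIdeal z p s)
    (hf' : f ∉ weightIdeal z p (s + 1)) (hg : g ∈ weightIdeal z p t)
    (hg' : g ∉ weightIdeal z p (t + 1)) : f * g ∉ weightIdeal z p (s + t + 1) := by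
  rw [← weightIdeal_one_eq_span hp] at hP
  have key : ∀ {s : ℕ} {f : O}, f ∈ weightIdeal z p s → f ∉ weightIdeal z p (s + 1) →
      ∃ F : MvPolynomial (Fin n) O, F.IsWeightedHomogeneous p s ∧
        f - eval z F ∈ weightIdeal z p (s + 1) ∧
        F.map (Ideal.Quotient.mk (weightIdeal z p 1)) ≠ 0 := by
    intro s f hf hf'
    obtain ⟨F, hF, h⟩ := exists_isWeightedHomogeneous hf
    refine ⟨F, hF, h, fun h0 => hf' ?_⟩
    rw [← sub_add_cancel f (eval z F)]
    refine Ideal.add_mem _ h ?_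
    rw [add_comm s]
    refine eval_mem_weightIdeal z hF fun d => ?_
    rw [← Ideal.Quotient.eq_zero_iff_mem, ← coeff_map, h0, coeff_zero]
  obtain ⟨F, hF, h1, h2⟩ := key hf hf'
  obtain ⟨G, hG, h3, h4⟩ := key hg hg'
  intro h
  have hFG : eval z (F * G) ∈ weightIdeal z p (s + t + 1) := by
    have hF' : eval z F ∈ weightIdeal z p s := by
      simpa using eval_mem_weightIdeal z (e := 0) hF (by simp [weightIdeal_of_nonpos])
    have e : eval z (F * G) = f * g - ((f - eval z F) * g + eval z F * (g - eval z G)) := by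
      rw [map_mul]; ring
    rw [e]
    refine Ideal.sub_mem _ h (Ideal.add_mem _ ?_ ?_)
    · exact weightIdeal_anti z p (by omega) (weightIdeal_mul_le z p _ _ (Ideal.mul_mem_mul h1 hg))
    · exact weightIdeal_anti z p (by omega) (weightIdeal_mul_le z p _ _ (Ideal.mul_mem_mul hF' h3))
  refine mul_ne_zero h2 h4 ?_
  rw [← map_mul]
  ext d
  rw [coeff_map, coeff_zero, Ideal.Quotient.eq_zero_iff_mem]
  exact coeff_mem_of_eval_mem hO hz hp (hF.mul hG) hFG d

/-- With a full system of parameters and all weights 1 the filtration is the `𝔪`-adic one, the ideal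
of parameters is the prime `𝔪`, and Krull's intersection theorem gives every nonzero element a
finite order. -/
theorem HasEnoughDerivations.isDomain (hO : HasEnoughDerivations k O) : IsDomain O := by
  have := hO.isNoetherianRing
  obtain ⟨n, z, hz, hspan⟩ := exists_parameters (O := O)
  have hpow (s : ℕ) : weightIdeal z (1 : Fin n → ℕ) s = maximalIdeal O ^ s := by
    rw [weightIdeal_one_weight_eq_pow, hspan]
  have key : ∀ f : O, f ≠ 0 → ∃ s, f ∈ maximalIdeal O ^ s ∧ f ∉ maximalIdeal O ^ (s + 1) := by
    intro f hf
    by_contra! h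
    have h1 (s : ℕ) : f ∈ maximalIdeal O ^ s := by
      induction s with
      | zero => simp
      | succ s ih => exact h s ih
    have h2 := Ideal.iInf_pow_eq_bot_of_isLocalRing (maximalIdeal O)
      (maximalIdeal.isMaximal O).ne_top
    exact hf (by rw [← Ideal.mem_bot, ← h2]; exact Ideal.mem_iInf.2 h1)
  have : NoZeroDivisors O := ⟨fun {f g} hfg => by
    by_contra! h
    obtain ⟨s, hs, hs'⟩ := key f h.1
    obtain ⟨t, ht, ht'⟩ := key g h.2
    simp only [← hpow] at hs hs' ht ht'
    refine mul_notMem_weightIdeal hO hz (hspan ▸ (maximalIdeal.isMaximal O).isPrime)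
      (fun _ => one_pos) hs hs' ht ht' ?_
    rw [hfg]
    exact Ideal.zero_mem _⟩
  exact NoZeroDivisors.to_isDomain O

theorem HasEnoughDerivations.isPrime_span (hO : HasEnoughDerivations k O) {n : ℕ} {z : Fin n → O}
    (hz : IsPartialParameters z) : (Ideal.span (Set.range z)).IsPrime := by
  have := isLocalRing_quotient (K := Ideal.span (Set.range z)) (Ideal.span_le.2 (by
    rintro _ ⟨i, rfl⟩
    exact hz.mem i))
  rw [← Ideal.Quotient.isDomain_iff_prime]
  exact (hO.quotient hz rfl).isDomain

/-- The filtration by weights is integrally closed. -/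
theorem HasEnoughDerivations.mem_weightIdeal_of_pow_mem (hO : HasEnoughDerivations k O) {n : ℕ}
    {z : Fin n → O} (hz : IsPartialParameters z) {p : Fin n → ℕ} (hp : ∀ i, 0 < p i) {N c : ℕ}
    (hN : 0 < N) {f : O} (h : f ^ N ∈ weightIdeal z p (N * c)) : f ∈ weightIdeal z p c := by
  have hP := hO.isPrime_span hz
  by_contra hf
  obtain ⟨s, hs, hs', hsc⟩ : ∃ s, f ∈ weightIdeal z p s ∧ f ∉ weightIdeal z p (s + 1) ∧ s < c := by
    by_contra! h
    refine hf ?_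
    have (t : ℕ) (ht : t ≤ c) : f ∈ weightIdeal z p t := by
      induction t with
      | zero => simp [weightIdeal_of_nonpos]
      | succ t ih =>
        by_contra h'
        have := h t (ih (by omega)) h'
        omega
    exact this c le_rfl
  have key (t : ℕ) : f ^ t ∈ weightIdeal z p (t * s) ∧ f ^ t ∉ weightIdeal z p (t * s + 1) := by
    induction t with
    | zero =>
      refine ⟨by simp [weightIdeal_of_nonpos], ?_⟩
      simp only [pow_zero, zero_mul, zero_add, weightIdeal_one_eq_span hp]
      exact (Ideal.ne_top_iff_one _).1 hP.ne_top
    | succ t ih =>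
      rw [pow_succ, Nat.succ_mul]
      exact ⟨weightIdeal_mul_le z p _ _ (Ideal.mul_mem_mul ih.1 hs),
        mul_notMem_weightIdeal hO hz hP hp ih.1 ih.2 hs hs'⟩
  -- The exact weight `s < c` of `f` makes the exact weight of `f ^ N` equal to `N * s`, and `N * s
  -- + 1 ≤ N * c` because `N > 0`.
  refine (key N).2 (weightIdeal_anti z p ?_ h)
  have := Nat.mul_le_mul_left N (Nat.succ_le_of_lt hsc)
  rw [Nat.mul_succ] at this
  omega

end Graded

/-! ### Order, maximal contact and coefficient ideals -/

section MaximalContact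

open IsLocalRing

variable {k : Type u} [Field k] {O : Type v} [CommRing O] [Algebra k O]

theorem order_eq_iff {I : Ideal O} {a : ℕ} :
    order k I = a ↔ derivIdeal k a I = ⊤ ∧ ∀ j < a, derivIdeal k j I ≠ ⊤ := by
  constructor
  · intro h
    have h1 : ∀ j < a, derivIdeal k j I ≠ ⊤ := fun j hj hj' => by
      have : order k I ≤ j := iInf₂_le j hj'
      rw [h] at this
      exact absurd (by exact_mod_cast this) (not_le.2 hj)
    refine ⟨?_, h1⟩
    by_contra h2
    have : ((a + 1 : ℕ) : ℕ∞) ≤ order k I := le_iInf₂ fun j hj => by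
      by_contra! hlt
      have hja : j ≤ a := Nat.lt_succ_iff.1 (by exact_mod_cast hlt)
      rcases hja.eq_or_lt with rfl | hja
      · exact h2 hj
      · exact h1 j hja hj
    rw [h] at this
    exact absurd (by exact_mod_cast this) (Nat.not_succ_le_self a)
  · rintro ⟨h1, h2⟩
    refine le_antisymm (iInf₂_le a h1) (le_iInf₂ fun j hj => ?_)
    by_contra! hlt
    exact h2 j (by exact_mod_cast hlt) hj

/-- The weight `i` of `𝒟^{a-i}(I)` is scaled by `q`. This serves the `𝔪`-adic filtration with `q =
1` and the weight filtrations with `q` the largest weight. -/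
theorem coeffIdeal_le_filtration {F : ℕ → Ideal O} (anti : Antitone F)
    (mul : ∀ m n, F m * F n ≤ F (m + n)) (zero : F 0 = ⊤) {I : Ideal O} {a q : ℕ}
    (h : ∀ i ≤ a, derivIdeal k (a - i) I ≤ F (i * q)) :
    coeffIdeal k I a ≤ F (a.factorial * q) := by
  have pow (c n : ℕ) : F c ^ n ≤ F (n * c) := by
    induction n with
    | zero => simp [zero]
    | succ n ih =>
      rw [pow_succ, Nat.succ_mul]
      exact (Ideal.mul_mono_left ih).trans (mul _ _)
  refine iSup₂_le fun b hb => ?_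
  have key (s : Finset ℕ) (hs : s ⊆ Finset.Icc 1 a) :
      ∏ i ∈ s, derivIdeal k (a - i) I ^ b i ≤ F ((∑ i ∈ s, i * b i) * q) := by
    induction s using Finset.induction_on with
    | empty => simp [zero]
    | insert i s hi ih =>
      rw [Finset.prod_insert hi, Finset.sum_insert hi, add_mul]
      refine le_trans (Ideal.mul_mono ?_ (ih fun j hj => hs (Finset.mem_insert_of_mem hj)))
        (mul _ _)
      refine (Ideal.pow_right_mono (h i (Finset.mem_Icc.1 (hs (Finset.mem_insert_self i s))).2)
        (b i)).trans ((pow _ _).trans (anti (le_of_eq ?_)))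
      ring
  exact (key _ subset_rfl).trans (anti (Nat.mul_le_mul_right q hb))

theorem pow_mem_coeffIdeal {I : Ideal O} {a i : ℕ} (hi : i ∈ Finset.Icc 1 a) {f : O}
    (hf : f ∈ derivIdeal k (a - i) I) : f ^ (a.factorial / i) ∈ coeffIdeal k I a := by
  classical
  have h := Finset.mem_Icc.1 hi
  refine Ideal.mem_iSup_of_mem (Pi.single i (a.factorial / i)) (Ideal.mem_iSup_of_mem ?_ ?_)
  · rw [Finset.sum_eq_single i (by simp_all) (by simp_all), Pi.single_eq_same,
      Nat.mul_div_cancel' (Nat.dvd_factorial h.1 h.2)]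
  · rw [Finset.prod_eq_single i (by simp_all) (by simp_all), Pi.single_eq_same]
    exact Ideal.pow_mem_pow hf _

/-- The Euler operator `x ∂`, where `∂ x = 1`, is bijective on the multiples of `x`, modulo each
ideal stable under it which contains a power of `x`. -/
theorem mem_of_euler_mem [CharZero k] {δ : Derivation k O O} {x : O} (hx : δ x = 1) {M : Ideal O}
    (hM : ∀ f ∈ M, x * δ f ∈ M) {t : ℕ} (ht : x ^ t ∈ M) {f : O} (hf : x ∣ f)
    (h : x * δ f ∈ M) : f ∈ M := by
  -- Since `x δ(x^(i+1) q) = (i+1) x^(i+1) q + x^(i+2) δ q`, the element `x^(i+1) q` is modulo `M` a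
  -- multiple of `x^(i+2)`. The number `d` bounds how often this is repeated before `x^t ∈ M`
  -- divides.
  have key (d : ℕ) : ∀ i, t ≤ i + 1 + d → ∀ q, x * δ (x ^ (i + 1) * q) ∈ M →
      x ^ (i + 1) * q ∈ M := by
    induction d with
    | zero => exact fun i hi q _ =>
      Ideal.mul_mem_right _ _ (Ideal.mem_of_dvd _ (pow_dvd_pow x hi) ht)
    | succ d ih =>
      intro i hi q hq
      obtain ⟨u, hu⟩ := isUnit_natCast (k := k) (O := O) i.succ_ne_zero
      have e : x * δ (x ^ (i + 1) * q) = (u : O) * (x ^ (i + 1) * q) + x ^ (i + 2) * δ q := by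
        rw [δ.leibniz, δ.leibniz_pow, hx, hu]
        simp
        ring
      have e' : x ^ (i + 1) * q = (↑u⁻¹ : O) * (x * δ (x ^ (i + 1) * q)) +
          x ^ (i + 1 + 1) * (-(↑u⁻¹ : O) * δ q) := by
        rw [e, mul_add, Units.inv_mul_cancel_left]
        ring
      have hm := Ideal.mul_mem_left _ (↑u⁻¹ : O) hq
      rw [e']
      refine Ideal.add_mem _ hm (ih (i + 1) (by omega) _ ?_)
      rw [← sub_eq_of_eq_add' e', map_sub, mul_sub]
      exact Ideal.sub_mem _ hq (hM _ hm)
  obtain ⟨q, rfl⟩ := hf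
  simpa using key t 0 (by omega) q (by simpa using h)

theorem restrictedCoeffIdeal_le_weightIdeal {I : Ideal O} {a n p₀ : ℕ} {z : Fin (n + 1) → O}
    {p : Fin (n + 1) → ℕ} (hp : ∀ i, 0 < p i) (hp₀ : ∀ i, p i ≤ p₀)
    (h : I ≤ weightIdeal z p (a * p₀)) :
    restrictedCoeffIdeal k I a (z 0) ≤
      weightIdeal (fun i : Fin n => Ideal.Quotient.mk (Ideal.span {z 0}) (z i.succ))
        (fun i => p i.succ) (a.factorial * p₀) := by
  rw [← map_mk_weightIdeal]
  refine Ideal.map_mono (coeffIdeal_le_filtration (weightIdeal_anti z p) (weightIdeal_mul_le z p)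
    (weightIdeal_of_nonpos z p le_rfl) fun i hi => ?_)
  refine (derivIdeal_le_weightIdeal hp hp₀ h).trans (weightIdeal_anti z p ?_)
  rw [← Nat.mul_sub_right_distrib, Nat.sub_sub_self hi]

variable [IsLocalRing O]

theorem HasEnoughDerivations.exists_derivation_eq_one (hO : HasEnoughDerivations k O) {x : O}
    (hx : x ∈ maximalIdeal O) (hx2 : x ∉ maximalIdeal O ^ 2) :
    ∃ δ : Derivation k O O, δ x = 1 := by
  obtain ⟨δ, u, hu⟩ := hO.exists_isUnit x hx hx2
  exact ⟨(↑u⁻¹ : O) • δ, by simp [← hu]⟩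

/-- Integration in characteristic 0: each derivation dropped gains one power of `𝔪`. With
`not_le_pow_of_derivIdeal_eq_top` this identifies the differential order with the `𝔪`-adic one. -/
theorem HasEnoughDerivations.derivIdeal_le_pow [CharZero k] (hO : HasEnoughDerivations k O)
    {I : Ideal O} {N s : ℕ} (h : derivIdeal k N I ≤ maximalIdeal O ^ (s + 1)) {j : ℕ} (hj : j ≤ N) :
    derivIdeal k (N - j) I ≤ maximalIdeal O ^ (j + s + 1) := by
  induction j with
  | zero => simpa using h
  | succ j ih =>
    intro f hf
    have : j + 1 + s + 1 = (j + s + 1) + 1 := by ring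
    rw [this]
    refine hO.mem_pow_of_forall_derivation_mem ?_ fun δ => ?_
    · exact Ideal.pow_le_self s.succ_ne_zero (h (derivIdeal_mono I (Nat.sub_le _ _) hf))
    · have h1 := derivation_mem_derivIdeal δ hf
      have h2 : N - (j + 1) + 1 = N - j := by omega
      rw [h2] at h1
      exact ih (by omega) h1

theorem HasEnoughDerivations.le_pow [CharZero k] (hO : HasEnoughDerivations k O)
    {I : Ideal O} {N s : ℕ} (h : derivIdeal k N I ≤ maximalIdeal O ^ (s + 1)) :
    I ≤ maximalIdeal O ^ (N + s + 1) :=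
  (le_derivIdeal (k := k) 0 I).trans (by simpa using hO.derivIdeal_le_pow h le_rfl)

theorem not_le_pow_of_derivIdeal_eq_top {I : Ideal O} {a n : ℕ} (h : derivIdeal k a I = ⊤)
    (hI : I ≤ maximalIdeal O ^ n) : n ≤ a := by
  by_contra! hlt
  have h1 := h.ge.trans (derivIdeal_le_pow hI)
  exact (maximalIdeal.isMaximal O).ne_top (top_le_iff.1 (h1.trans (Ideal.pow_le_self (by omega))))

/-- If every `𝒟^N(I)` were proper, then `I` would lie in all powers of `𝔪`, hence be zero. -/
theorem HasEnoughDerivations.exists_order_eq [CharZero k] (hO : HasEnoughDerivations k O)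
    {I : Ideal O} (hI : I ≤ maximalIdeal O) (h0 : I ≠ ⊥) :
    ∃ a : ℕ, 0 < a ∧ order k I = a := by
  classical
  have := hO.isNoetherianRing
  have hex : ∃ a, derivIdeal k a I = ⊤ := by
    by_contra! h
    refine h0 (le_bot_iff.1 ?_)
    rw [← Ideal.iInf_pow_eq_bot_of_isLocalRing (maximalIdeal O) (maximalIdeal.isMaximal O).ne_top]
    refine le_iInf fun N => ?_
    exact (hO.le_pow (s := 0) (by simpa using le_maximalIdeal (h N))).trans
      (Ideal.pow_le_pow_right (by omega))
  refine ⟨Nat.find hex, ?_, order_eq_iff.2 ⟨Nat.find_spec hex, fun j hj => Nat.find_min hex hj⟩⟩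
  have := not_le_pow_of_derivIdeal_eq_top (n := 1) (Nat.find_spec hex) (by simpa using hI)
  omega

/-- If `𝒟^{a-1}(I)` were contained in `𝔪²`, then `I ⊆ 𝔪^(a+1)`, against `𝒟^a(I) = O`. Any element of
`𝒟^{a-1}(I)` outside `𝔪²` serves. -/
theorem HasEnoughDerivations.exists_isMaximalContact [CharZero k]
    (hO : HasEnoughDerivations k O) {I : Ideal O} {a : ℕ} (ha : 0 < a) (h : order k I = a) :
    ∃ x, IsMaximalContact k I a x := by
  obtain ⟨h1, h2⟩ := order_eq_iff.1 h
  have hm : derivIdeal k (a - 1) I ≤ maximalIdeal O := le_maximalIdeal (h2 _ (by omega))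
  have hm2 : ¬ derivIdeal k (a - 1) I ≤ maximalIdeal O ^ 2 := fun hle => by
    have := not_le_pow_of_derivIdeal_eq_top h1 (hO.le_pow (s := 1) hle)
    omega
  obtain ⟨x, hx, hx2⟩ := SetLike.not_le_iff_exists.1 hm2
  obtain ⟨δ, hδ⟩ := hO.exists_isUnit x (hm hx) hx2
  exact ⟨x, ha, h, hx, Ideal.eq_top_of_isUnit_mem _ (apply_mem_derivIdeal
    (isDiffOp_one_derivation δ) (Ideal.mem_span_singleton_self x)) hδ⟩

namespace IsMaximalContact

variable {I : Ideal O} {a : ℕ} {x : O}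

theorem derivIdeal_le_maximalIdeal (hx : IsMaximalContact k I a x) :
    derivIdeal k (a - 1) I ≤ maximalIdeal O :=
  le_maximalIdeal ((order_eq_iff.1 hx.order_eq).2 _ (by have := hx.pos; omega))

theorem mem_maximalIdeal (hx : IsMaximalContact k I a x) : x ∈ maximalIdeal O :=
  hx.derivIdeal_le_maximalIdeal hx.mem

theorem notMem_sq (hx : IsMaximalContact k I a x) : x ∉ maximalIdeal O ^ 2 := fun h => by
  have := not_le_pow_of_derivIdeal_eq_top hx.deriv_eq_top
    ((Ideal.span_singleton_le_iff_mem _).2 h)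
  omega

/-- `𝒟^{a-i}(I) ⊆ 𝔪^i` by integration. The bound forces the exponents on `V(x)` to be at least `a!`,
so that after division by `(a-1)!` they are at least `a`. -/
theorem coeffIdeal_le [CharZero k] (hx : IsMaximalContact k I a x)
    (hO : HasEnoughDerivations k O) : coeffIdeal k I a ≤ maximalIdeal O ^ a.factorial := by
  have hpos := hx.pos
  have := coeffIdeal_le_filtration (k := k) (F := fun n => maximalIdeal O ^ n) (q := 1) (I := I)
    (a := a) (fun _ _ h => Ideal.pow_le_pow_right h) (fun m n => (pow_add _ m n).ge) (by simp)
    fun i hi => ?_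
  · simpa using this
  obtain _ | i := i
  · simp
  · have h := hO.derivIdeal_le_pow (s := 0) (by simpa using hx.derivIdeal_le_maximalIdeal)
      (j := i) (by omega)
    rw [Nat.sub_sub, add_comm 1] at h
    simpa using h

/-- The lifting step from `V(x)` to `O`. The bound is proved for all `𝒟^{a-i}(I)` by induction on
`i`, because the control of `g ∈ 𝒟^{a-i-1}(I)` uses its derivative `δ g ∈ 𝒟^{a-i}(I)`. -/
theorem le_weightIdeal [CharZero k] (hx : IsMaximalContact k I a x)
    (hO : HasEnoughDerivations k O) {n : ℕ} {z : Fin n → O}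
    (hz : IsPartialParameters (Fin.cons x z : Fin (n + 1) → O)) {p : Fin n → ℕ} {p₀ : ℕ}
    (hp : ∀ i, 0 < p i) (hp₀ : ∀ i, p i ≤ p₀) (hpos : 0 < p₀)
    (h : restrictedCoeffIdeal k I a x ≤
      weightIdeal (fun i => Ideal.Quotient.mk (Ideal.span {x}) (z i)) p (a.factorial * p₀)) :
    I ≤ weightIdeal (Fin.cons x z : Fin (n + 1) → O) (Fin.cons p₀ p : Fin (n + 1) → ℕ)
      (a * p₀) := by
  have hxm := hx.mem_maximalIdeal
  have := isLocalRing_quotient ((Ideal.span_singleton_le_iff_mem _).2 hxm)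
  have hO' := hO.quotient_span_singleton hxm hx.notMem_sq
  obtain ⟨δ, hδ⟩ := hO.exists_derivation_eq_one hxm hx.notMem_sq
  set y : Fin (n + 1) → O := Fin.cons x z with hy
  set w : Fin (n + 1) → ℕ := Fin.cons p₀ p with hw
  have hw0 : ∀ i, 0 < w i := Fin.cases hpos hp
  have hwp : ∀ i, w i ≤ p₀ := Fin.cases le_rfl hp₀
  have hxw (t : ℕ) : x ^ t ∈ weightIdeal y w (t * p₀) := by
    have : x ∈ weightIdeal y w p₀ := self_mem_weightIdeal y 0 le_rfl
    exact weightIdeal_pow_le y w p₀ t (Ideal.pow_mem_pow this t)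
  -- `δ` lowers the weight by at most `p₀`, and `x` has weight `p₀`, so the weight ideals are stable
  -- under `x δ`.
  have hδw (c : ℕ) (f : O) (hf : f ∈ weightIdeal y w c) : x * δ f ∈ weightIdeal y w c := by
    have h1 := derivIdeal_le_weightIdeal hw0 hwp
      ((Ideal.span_singleton_le_iff_mem (x := f) _).2 hf)
      (apply_mem_derivIdeal (isDiffOp_one_derivation δ) (Ideal.mem_span_singleton_self f))
    have h2 := Ideal.mul_mem_mul (by simpa using hxw 1) h1
    exact weightIdeal_anti y w (by omega) (weightIdeal_mul_le y w _ _ h2)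
  have key (i : ℕ) (hi : i ≤ a) : derivIdeal k (a - i) I ≤ weightIdeal y w (i * p₀) := by
    induction i with
    | zero => simp [weightIdeal_of_nonpos]
    | succ i ih =>
      intro g hg
      have h1 : Ideal.Quotient.mk (Ideal.span {x}) g ^ (a.factorial / (i + 1)) ∈
          restrictedCoeffIdeal k I a x := by
        rw [← map_pow]
        exact Ideal.mem_map_of_mem _ (pow_mem_coeffIdeal (Finset.mem_Icc.2 ⟨by omega, hi⟩) hg)
      have hdvd := Nat.dvd_factorial (Nat.succ_pos i) hi
      -- Integral closedness on `V(x)` extracts the root of exponent `a! / (i + 1)`.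
      have h2 := hO'.mem_weightIdeal_of_pow_mem hz.quotient hp (c := (i + 1) * p₀)
        (Nat.div_pos (Nat.le_of_dvd (Nat.factorial_pos a) hdvd) (Nat.succ_pos i)) (by
          rw [← mul_assoc, Nat.div_mul_cancel hdvd]
          exact h h1)
      obtain ⟨f, hf, q, rfl⟩ := exists_mem_weightIdeal_of_mk_mem h2
      have hf' : f ∈ weightIdeal y w ((i + 1) * p₀) := weightIdeal_tail_le y w _ hf
      -- It remains to bound `x * q`. Its image under `x δ` is `x δ g - x δ f`, where `x δ g` has
      -- weight at least `p₀ + i p₀` by the induction hypothesis.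
      refine Ideal.add_mem _ hf' (mem_of_euler_mem hδ (hδw _) (hxw (i + 1)) (dvd_mul_right x q) ?_)
      have e : x * δ (x * q) = x * δ (f + x * q) - x * δ f := by rw [map_add]; ring
      rw [e]
      refine Ideal.sub_mem _ ?_ (hδw _ f hf')
      have h3 := derivation_mem_derivIdeal δ hg
      have h4 : a - (i + 1) + 1 = a - i := by omega
      rw [h4] at h3
      have h5 := Ideal.mul_mem_mul (by simpa using hxw 1) (ih (by omega) h3)
      refine weightIdeal_anti y w (le_of_eq ?_) (weightIdeal_mul_le y w _ _ h5)
      ring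
  exact (le_derivIdeal (k := k) 0 I).trans (by simpa using key a le_rfl)

end IsMaximalContact

end MaximalContact

/-! ### Exchanging the first parameter -/

section Replacement

open IsLocalRing

variable {O : Type*} [CommRing O]

theorem prod_pow_eq_mul_prod_pow {ι : Type*} [Fintype ι] [DecidableEq ι] (z : ι → O) {m : ι → ℕ}
    {i : ι} (hi : m i ≠ 0) : ∏ j, z j ^ m j = z i * ∏ j, z j ^ (m - Pi.single i 1 : ι → ℕ) j := by
  generalize hm : (m - Pi.single i 1 : ι → ℕ) = m'
  rw [← Finset.mul_prod_erase _ _ (Finset.mem_univ i),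
    ← Finset.mul_prod_erase _ (fun j => z j ^ m' j) (Finset.mem_univ i), ← mul_assoc, ← pow_succ',
    ← hm]
  congr 1
  · simp [Nat.sub_add_cancel (Nat.one_le_iff_ne_zero.2 hi)]
  · refine Finset.prod_congr rfl fun j hj => ?_
    simp [Finset.ne_of_mem_erase hj]

/-- Monomials divisible by `z i₀` go into `d`. The others do not see the replacement of `z i₀` by
`x`, so their sum keeps its weight in the new parameters; this lets `z i₀` be recovered from `x`. -/
theorem exists_decomposition {ι : Type*} [Fintype ι] [DecidableEq ι] (z : ι → O) {p : ι → ℕ}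
    {p₀ : ℕ} (hpos : 0 < p₀) (i₀ : ι) (x : O) {f : O} (hf : f ∈ weightIdeal z p p₀) :
    ∃ (d : O) (e : ι → O), e i₀ = 0 ∧ f = d * z i₀ + ∑ i, e i * z i ∧
      ∑ i, e i * z i ∈ weightIdeal (Function.update z i₀ x) p p₀ := by
  refine Submodule.span_induction ?_ ⟨0, 0, by simp, by simp, by simp⟩ ?_ ?_ hf
  · rintro _ ⟨m, hm, rfl⟩
    by_cases h0 : m i₀ = 0
    · obtain ⟨i, -, hi⟩ := Finset.exists_ne_zero_of_sum_ne_zero (hpos.trans_le hm).ne'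
      have hi' : m i ≠ 0 := left_ne_zero_of_smul hi
      have hne : i₀ ≠ i := fun h => hi' (h ▸ h0)
      have e : ∑ j, (Pi.single i (∏ j, z j ^ (m - Pi.single i 1 : ι → ℕ) j) : ι → O) j * z j =
          ∏ j, z j ^ m j := by
        rw [prod_pow_eq_mul_prod_pow z hi']
        simp [Pi.single_apply, mul_comm]
      refine ⟨0, Pi.single i (∏ j, z j ^ (m - Pi.single i 1 : ι → ℕ) j), ?_, ?_, ?_⟩
      · simp [Pi.single_apply, hne]
      · rw [e]; simp
      · rw [e]
        have e' : ∏ j, z j ^ m j = ∏ j, Function.update z i₀ x j ^ m j := by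
          refine Finset.prod_congr rfl fun j _ => ?_
          by_cases hj : j = i₀
          · subst hj; simp [h0]
          · simp [hj]
        rw [e']
        exact prod_mem_weightIdeal _ m hm
    · exact ⟨∏ j, z j ^ (m - Pi.single i₀ 1 : ι → ℕ) j, 0, rfl, by
        rw [prod_pow_eq_mul_prod_pow z h0, mul_comm]; simp, by simp⟩
  · rintro a b _ _ ⟨d, e, h1, h2, h3⟩ ⟨d', e', h1', h2', h3'⟩
    have hs : ∑ i, (e + e') i * z i = ∑ i, e i * z i + ∑ i, e' i * z i := by
      simp [add_mul, Finset.sum_add_distrib]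
    refine ⟨d + d', e + e', by simp [h1, h1'], ?_, ?_⟩
    · rw [hs, h2, h2']; ring
    · rw [hs]
      exact Ideal.add_mem _ h3 h3'
  · rintro r a _ ⟨d, e, h1, h2, h3⟩
    have hs : ∑ i, (r • e) i * z i = r * ∑ i, e i * z i := by
      simp [Finset.mul_sum, mul_assoc]
    refine ⟨r * d, r • e, by simp [h1], ?_, ?_⟩
    · rw [hs, h2, smul_eq_mul]; ring
    · rw [hs]
      exact Ideal.mul_mem_left _ _ h3

variable [IsLocalRing O]

theorem IsPartialParameters.comp_equiv {ι κ : Type*} [Fintype ι] [Fintype κ] {z : ι → O}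
    (hz : IsPartialParameters z) (e : κ ≃ ι) : IsPartialParameters (z ∘ e) := by
  refine ⟨fun i => hz.mem (e i), fun c hc i => ?_⟩
  have := hz.coeff_mem (c ∘ e.symm) (by
    rw [← e.sum_comp]
    simpa using hc) (e i)
  simpa using this

/-- A monomial of degree one has weight at least `p₀` only if its variable has the top weight; those
of degree at least two lie in `𝔪²`. -/
theorem exists_linear_part {ι : Type*} [Fintype ι] {z : ι → O} (hz : ∀ i, z i ∈ maximalIdeal O)
    {p : ι → ℕ} {p₀ : ℕ} (hpos : 0 < p₀) (hp₀ : ∀ i, p i ≤ p₀) {f : O}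
    (hf : f ∈ weightIdeal z p p₀) : ∃ c : ι → O, (∀ i, p i ≠ p₀ → c i = 0) ∧
      f - ∑ i, c i * z i ∈ maximalIdeal O ^ 2 := by
  classical
  refine Submodule.span_induction ?_ ⟨0, by simp, by simp⟩ ?_ ?_ hf
  · rintro _ ⟨m, hm, rfl⟩
    obtain ⟨i, -, hi⟩ := Finset.exists_ne_zero_of_sum_ne_zero (hpos.trans_le hm).ne'
    have hi' : m i ≠ 0 := left_ne_zero_of_smul hi
    rw [prod_pow_eq_mul_prod_pow z hi']
    by_cases h : m - Pi.single i 1 = 0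
    · have hm' : m = Pi.single i 1 := by
        ext j
        have := congr_fun h j
        by_cases hj : j = i
        · subst hj; simp at this ⊢; omega
        · simpa [hj] using this
      refine ⟨Pi.single i 1, fun j hj => ?_, ?_⟩
      · rw [Pi.single_apply, if_neg]
        rintro rfl
        refine hj (le_antisymm (hp₀ j) ?_)
        simpa [hm', Pi.single_apply] using hm
      · rw [h]
        simp [Pi.single_apply]
    · obtain ⟨j, hj⟩ := Function.ne_iff.1 h
      refine ⟨0, by simp, ?_⟩
      rw [prod_pow_eq_mul_prod_pow z hj, pow_two]
      simpa using Ideal.mul_mem_mul (hz i) (Ideal.mul_mem_right _ _ (hz j))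
  · rintro a b _ _ ⟨c, hc, h⟩ ⟨d, hd, h'⟩
    refine ⟨c + d, fun i hi => by simp [hc i hi, hd i hi], ?_⟩
    convert Ideal.add_mem _ h h' using 1
    simp [add_mul, Finset.sum_add_distrib]
    ring
  · rintro r a _ ⟨c, hc, h⟩
    refine ⟨r • c, fun i hi => by simp [hc i hi], ?_⟩
    convert Ideal.mul_mem_left _ r h using 1
    simp [mul_sub, Finset.mul_sum, mul_assoc]

/-- An element of `𝔪 ∖ 𝔪²` of maximal weight can be used as the first parameter. -/
theorem IsPartialParameters.exists_replacement {n : ℕ} {z : Fin (n + 1) → O}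
    (hz : IsPartialParameters z) {p : Fin (n + 1) → ℕ} (hp : 0 < p 0)
    (hp₀ : ∀ i, p i ≤ p 0) {x : O} (hxm : x ∈ maximalIdeal O) (hx2 : x ∉ maximalIdeal O ^ 2)
    (hx : x ∈ weightIdeal z p (p 0)) :
    ∃ y : Fin n → O, IsPartialParameters (Fin.cons x y : Fin (n + 1) → O) ∧
      ∀ c, weightIdeal (Fin.cons x y : Fin (n + 1) → O) p c = weightIdeal z p c := by
  obtain ⟨c, hc, hxc⟩ := exists_linear_part hz.mem hp hp₀ hx
  obtain ⟨i₀, hi₀⟩ : ∃ i, c i ∉ maximalIdeal O := by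
    by_contra! h
    refine hx2 ?_
    rw [← sub_add_cancel x (∑ i, c i * z i)]
    refine Ideal.add_mem _ hxc (Ideal.sum_mem _ fun i _ => ?_)
    rw [pow_two]
    exact Ideal.mul_mem_mul (h i) (hz.mem i)
  have hpi : p i₀ = p 0 := by
    by_contra h
    exact hi₀ (by simp [hc i₀ h])
  obtain ⟨d, e, he, hxe, hr⟩ := exists_decomposition z hp i₀ x hx
  -- Modulo `𝔪`, `d` is the coefficient `c i₀` of the linear part of `x`.
  have hd : IsUnit d := by
    have h1 := hz.coeff_mem (fun i => (if i = i₀ then d else 0) + e i - c i) (by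
      rw [hxe] at hxc
      simpa [sub_mul, add_mul, Finset.sum_add_distrib, Finset.sum_sub_distrib, ite_mul]
        using hxc) i₀
    simp only [if_true, he, add_zero] at h1
    by_contra h
    refine hi₀ ?_
    rw [← sub_sub_cancel d (c i₀)]
    exact Ideal.sub_mem _ h h1
  set z' := Function.update z i₀ x with hz'
  have hne (j) (hj : j ≠ i₀) : z' j = z j := Function.update_of_ne hj _ _
  have heq : z' i₀ = x := Function.update_self _ _ _
  have hw (c : ℕ) : weightIdeal z' p c = weightIdeal z p c := by
    refine le_antisymm (weightIdeal_le_of_forall_mem (fun j => ?_) c)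
      (weightIdeal_le_of_forall_mem (fun j => ?_) c) <;> rcases eq_or_ne j i₀ with rfl | hj
    · rw [heq, hpi]
      exact hx
    · rw [hne j hj]
      exact self_mem_weightIdeal z j le_rfl
    · obtain ⟨u, rfl⟩ := hd
      have e1 : z j = (↑u⁻¹ : O) * (x - ∑ i, e i * z i) := by
        rw [hxe, add_sub_cancel_right, Units.inv_mul_cancel_left]
      rw [e1, hpi]
      refine Ideal.mul_mem_left _ _ (Ideal.sub_mem _ ?_ hr)
      rw [← heq]
      exact self_mem_weightIdeal z' j hpi.ge
    · rw [← hne j hj]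
      exact self_mem_weightIdeal z' j le_rfl
  have hpar : IsPartialParameters z' := by
    refine ⟨fun j => ?_, fun f hf => ?_⟩
    · rcases eq_or_ne j i₀ with rfl | hj
      · rwa [heq]
      · rw [hne j hj]
        exact hz.mem j
    have h1 := hz.coeff_mem (fun i => (if i = i₀ then f i₀ * d else f i) + f i₀ * e i) (by
      convert hf using 1
      rw [← Finset.add_sum_erase _ _ (Finset.mem_univ i₀),
        ← Finset.add_sum_erase _ (fun i => f i * z' i) (Finset.mem_univ i₀), heq, if_pos rfl, he]
      conv_rhs => rw [hxe]
      rw [← Finset.add_sum_erase _ (fun i => e i * z i) (Finset.mem_univ i₀), he]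
      have : ∑ j ∈ Finset.univ.erase i₀, ((if j = i₀ then f i₀ * d else f j) + f i₀ * e j) * z j =
          f i₀ * ∑ j ∈ Finset.univ.erase i₀, e j * z j +
            ∑ j ∈ Finset.univ.erase i₀, f j * z' j := by
        rw [Finset.mul_sum, ← Finset.sum_add_distrib]
        refine Finset.sum_congr rfl fun j hj => ?_
        have hj' := Finset.ne_of_mem_erase hj
        rw [if_neg hj', hne j hj']
        ring
      rw [this]
      ring)
    have h2 : f i₀ ∈ maximalIdeal O := by
      have := h1 i₀
      rw [if_pos rfl, he, mul_zero, add_zero, mul_comm] at this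
      exact (Ideal.unit_mul_mem_iff_mem _ hd).1 this
    intro j
    rcases eq_or_ne j i₀ with rfl | hj
    · exact h2
    · have := h1 j
      rw [if_neg hj] at this
      exact (Ideal.add_mem_iff_left _ (Ideal.mul_mem_right _ _ h2)).1 this
  -- The swap moves `x` to the front and preserves the weights, since `p i₀ = p 0`.
  let σ : Equiv.Perm (Fin (n + 1)) := Equiv.swap 0 i₀
  have hcons : (Fin.cons x fun i : Fin n => z' (σ i.succ) : Fin (n + 1) → O) = z' ∘ σ := by
    refine funext fun j => Fin.cases ?_ (fun j => ?_) j
    · simp [σ, heq]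
    · simp
  have hpσ : p ∘ σ = p := by
    ext j
    rcases eq_or_ne j 0 with rfl | h0
    · simp [σ, hpi]
    rcases eq_or_ne j i₀ with rfl | h1
    · simp [σ, hpi]
    · simp [σ, Equiv.swap_apply_of_ne_of_ne h0 h1]
  refine ⟨fun i => z' (σ i.succ), ?_, fun c => ?_⟩
  · rw [hcons]
    exact hpar.comp_equiv σ
  · rw [hcons, ← hw c, ← weightIdeal_comp_equiv σ z' p c, hpσ]

end Replacement

/-! ### Centers as weighted parameters -/

section Presentations

open IsLocalRing

variable {O : Type*} [CommRing O] {n : ℕ}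

theorem monomialIdeal_ofFn (F : Fin n → O × ℚ) (c : ℝ≥0) :
    monomialIdeal (List.ofFn F) c =
      weightIdeal (fun i => (F i).1) (fun i => ((F i).2 : ℝ)⁻¹) (c : ℝ) := by
  have h (J : Presentation O) : monomialIdeal J c =
      weightIdeal (fun i => (J.get i).1) (fun i => ((J.get i).2 : ℝ)⁻¹) (c : ℝ) := by
    simp [monomialIdeal, weightIdeal, div_eq_mul_inv]
  rw [h, ← weightIdeal_comp_equiv (finCongr (List.length_ofFn (f := F)))]
  congr 1 <;> ext i <;> simp [finCongr] <;> rfl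

theorem isCenter_ofFn [IsLocalRing O] {F : Fin n → O × ℚ} :
    IsCenter (List.ofFn F) ↔ (∀ i, 0 < (F i).2) ∧ (Monotone fun i => (F i).2) ∧
      IsPartialParameters fun i => (F i).1 := by
  let e := finCongr (List.length_ofFn (f := F))
  have hget (i) : (List.ofFn F).get i = F (e i) := by
    simp [e, finCongr]
    rfl
  have hli (h : ∀ i, ((List.ofFn F).get i).1 ∈ maximalIdeal O) :
      (LinearIndependent (ResidueField O) fun i : Fin (List.ofFn F).length =>
        (maximalIdeal O).toCotangent ⟨((List.ofFn F).get i).1, h i⟩) ↔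
      ∀ c : Fin (List.ofFn F).length → O, ∑ i, c i * ((List.ofFn F).get i).1 ∈ maximalIdeal O ^ 2 →
        ∀ i, c i ∈ maximalIdeal O := by
    have hsum (c : Fin (List.ofFn F).length → O) :
        ∑ i, residue O (c i) • (maximalIdeal O).toCotangent ⟨((List.ofFn F).get i).1, h i⟩ = 0 ↔
          ∑ i, c i * ((List.ofFn F).get i).1 ∈ maximalIdeal O ^ 2 := by
      have e1 : ∑ i, residue O (c i) • (maximalIdeal O).toCotangent
          ⟨((List.ofFn F).get i).1, h i⟩ =
          (maximalIdeal O).toCotangent (∑ i, c i • ⟨((List.ofFn F).get i).1, h i⟩) := by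
        rw [map_sum]
        exact Finset.sum_congr rfl fun i _ => by rw [map_smul]; rfl
      rw [e1, Ideal.toCotangent_eq_zero]
      simp
    rw [Fintype.linearIndependent_iff]
    constructor
    · intro H c hc i
      rw [← residue_eq_zero_iff]
      exact H (fun i => residue O (c i)) ((hsum c).2 hc) i
    · intro H g hg i
      choose c hc using fun i => residue_surjective (R := O) (g i)
      simp only [← hc] at hg ⊢
      rw [residue_eq_zero_iff]
      exact H c ((hsum c).1 hg) i
  constructor
  · rintro ⟨h1, h2, h3, h4⟩
    rw [hli h3] at h4
    simp only [hget] at h1 h2 h3 h4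
    have h5 : IsPartialParameters ((fun i => (F i).1) ∘ e) := ⟨h3, h4⟩
    refine ⟨fun i => by simpa using h1 (e.symm i), fun i j hij => ?_, ?_⟩
    · simpa using h2 (show e.symm i ≤ e.symm j from hij)
    · simpa [Function.comp_assoc] using h5.comp_equiv e.symm
  · rintro ⟨h1, h2, h3⟩
    have h5 := h3.comp_equiv e
    have h6 (i) : ((List.ofFn F).get i).1 ∈ maximalIdeal O := by
      rw [hget]; exact h3.mem _
    refine ⟨fun i => ?_, fun i j hij => ?_, h6, (hli h6).2 ?_⟩
    · rw [hget]; exact h1 _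
    · simp only [hget]
      exact h2 (show e i ≤ e j from hij)
    · simp only [hget]
      exact h5.coeff_mem

/-- `D` is the product of the numerators, so each `D / b i` is an integer; it becomes the natural
weight of the `i`-th parameter. -/
theorem exists_common_multiple (b : Fin n → ℚ) (hb : ∀ i, 0 < b i) :
    ∃ (D : ℕ) (p : Fin n → ℕ), 0 < D ∧ ∀ i, 0 < p i ∧ (p i : ℚ) * b i = D := by
  have hnum (i) : 0 < (b i).num.natAbs := Int.natAbs_pos.2 (Rat.num_pos.2 (hb i)).ne'
  refine ⟨∏ i, (b i).num.natAbs, fun i => (b i).den * ∏ j ∈ Finset.univ.erase i, (b j).num.natAbs,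
    Finset.prod_pos fun i _ => hnum i, fun i => ⟨Nat.mul_pos (b i).den_pos
      (Finset.prod_pos fun i _ => hnum i), ?_⟩⟩
  have h1 : ((b i).num.natAbs : ℚ) = (b i).num := by
    rw [Nat.cast_natAbs, abs_of_pos (Rat.num_pos.2 (hb i))]
  rw [← Finset.mul_prod_erase _ _ (Finset.mem_univ i)]
  push_cast
  rw [mul_right_comm, mul_comm ((b i).den : ℚ), Rat.mul_den_eq_num, ← h1]

theorem monomialIdeal_ofFn_eq_weightIdeal {F : Fin n → O × ℚ} {p : Fin n → ℕ} {D : ℕ} (hD : 0 < D)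
    (hp : ∀ i, (p i : ℚ) * (F i).2 = D) (c : ℝ≥0) :
    monomialIdeal (List.ofFn F) c = weightIdeal (fun i => (F i).1) p ⌈(c : ℝ) * D⌉₊ := by
  rw [monomialIdeal_ofFn, ← weightIdeal_natCast_mul D hD]
  congr 1
  ext i
  have h : ((p i : ℝ) * ((F i).2 : ℝ)) = D := by exact_mod_cast hp i
  have hD' : (D : ℝ) ≠ 0 := by exact_mod_cast hD.ne'
  rw [inv_eq_iff_eq_inv, inv_div, eq_div_iff, mul_comm, h]
  rintro h0
  rw [h0, zero_mul] at h
  exact hD' h.symm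

theorem isAdmissible_ofFn_iff {F : Fin n → O × ℚ} {p : Fin n → ℕ} {D : ℕ} (hD : 0 < D)
    (hp : ∀ i, (p i : ℚ) * (F i).2 = D) {I : Ideal O} :
    IsAdmissible (List.ofFn F) I ↔ I ≤ weightIdeal (fun i => (F i).1) p D := by
  refine forall₂_congr fun f _ => ⟨fun h => ?_, fun h => ?_⟩
  · have hlt : (((D - 1 : ℕ) / D : ℝ≥0) : ℝ≥0∞) < valuation (List.ofFn F) f := by
      refine lt_of_lt_of_le ?_ h
      rw [ENNReal.coe_lt_one_iff, div_lt_one (by exact_mod_cast hD)]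
      exact_mod_cast Nat.sub_lt hD one_pos
    rw [valuation] at hlt
    obtain ⟨c, hc⟩ := lt_iSup_iff.1 hlt
    obtain ⟨hf, hc⟩ := lt_iSup_iff.1 hc
    rw [monomialIdeal_ofFn_eq_weightIdeal hD hp] at hf
    refine weightIdeal_anti _ p ?_ hf
    rw [ENNReal.coe_lt_coe, div_lt_iff₀ (by exact_mod_cast hD)] at hc
    have hc' : ((D - 1 : ℕ) : ℝ) < (c : ℝ) * D := by exact_mod_cast hc
    have := Nat.lt_ceil.2 hc'
    omega
  · refine le_iSup₂_of_le (f := fun (c : ℝ≥0) (_ : f ∈ monomialIdeal (List.ofFn F) c) =>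
      (c : ℝ≥0∞)) 1 ?_ (by simp)
    rw [monomialIdeal_ofFn_eq_weightIdeal hD hp]
    simpa using h

theorem valuation_congr {J J' : Presentation O} (h : ∀ c, monomialIdeal J c = monomialIdeal J' c) :
    valuation J = valuation J' := by
  ext f
  simp only [valuation, h]

/-- Two centers with the same first member are equal if their restrictions are equal. -/
theorem monomialIdeal_cons_le {m : ℕ} {x : O} {a q : ℕ} (ha : 0 < a) (hq : 0 < q)
    {F : Fin n → O × ℚ} {G : Fin m → O × ℚ} (hG : ∀ i, (a * q : ℚ) ≤ (G i).2)
    (h : ∀ c, monomialIdeal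
        (List.ofFn fun i => (Ideal.Quotient.mk (Ideal.span {x}) (F i).1, (F i).2)) c =
      monomialIdeal (List.ofFn fun i => (Ideal.Quotient.mk (Ideal.span {x}) (G i).1, (G i).2)) c)
    (c : ℝ≥0) :
    monomialIdeal ((x, (a : ℚ)) :: List.ofFn fun i => ((G i).1, (G i).2 / (q : ℚ))) c ≤
      monomialIdeal ((x, (a : ℚ)) :: List.ofFn fun i => ((F i).1, (F i).2 / (q : ℚ))) c := by
  have hcons {m : ℕ} (G : Fin m → O × ℚ) : ((x, (a : ℚ)) ::
      List.ofFn fun i => ((G i).1, (G i).2 / (q : ℚ))) = List.ofFn (Fin.cons (x, (a : ℚ))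
        (fun i => ((G i).1, (G i).2 / (q : ℚ))) : Fin (m + 1) → O × ℚ) := by
    rw [List.ofFn_succ]; rfl
  have ha' : (0 : ℝ) < a := by exact_mod_cast ha
  have hq' : (0 : ℝ) < q := by exact_mod_cast hq
  rw [hcons, hcons, monomialIdeal_ofFn, monomialIdeal_ofFn]
  refine weightIdeal_le_of_forall_mem (fun i => ?_) _
  set T := weightIdeal (fun i => ((Fin.cons (x, (a : ℚ))
    (fun i => ((F i).1, (F i).2 / (q : ℚ))) : Fin (n + 1) → O × ℚ) i).1)
    (fun i => (((Fin.cons (x, (a : ℚ))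
    (fun i => ((F i).1, (F i).2 / (q : ℚ))) : Fin (n + 1) → O × ℚ) i).2 : ℝ)⁻¹) with hT
  have hx : x ∈ T (a : ℝ)⁻¹ := by
    have := self_mem_weightIdeal (fun i => ((Fin.cons (x, (a : ℚ))
      (fun i => ((F i).1, (F i).2 / (q : ℚ))) : Fin (n + 1) → O × ℚ) i).1)
      (w := fun i => (((Fin.cons (x, (a : ℚ))
      (fun i => ((F i).1, (F i).2 / (q : ℚ))) : Fin (n + 1) → O × ℚ) i).2 : ℝ)⁻¹)
      (c := (a : ℝ)⁻¹) 0 (by simp)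
    exact this
  refine Fin.cases ?_ (fun i => ?_) i
  · simpa using hx
  have hGi : (a * q : ℝ) ≤ (G i).2 := by exact_mod_cast hG i
  have hpos : (0 : ℝ) < (G i).2 := lt_of_lt_of_le (by positivity) hGi
  have h1 : Ideal.Quotient.mk (Ideal.span {x}) (G i).1 ∈ weightIdeal
      (fun i => Ideal.Quotient.mk (Ideal.span {x}) (F i).1) (fun i => ((F i).2 : ℝ)⁻¹)
        ((G i).2 : ℝ)⁻¹ := by
    have h2 : weightIdeal (fun i => Ideal.Quotient.mk (Ideal.span {x}) (F i).1)
        (fun i => ((F i).2 : ℝ)⁻¹) ((G i).2 : ℝ)⁻¹ =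
          weightIdeal (fun i => Ideal.Quotient.mk (Ideal.span {x}) (G i).1)
            (fun i => ((G i).2 : ℝ)⁻¹) ((G i).2 : ℝ)⁻¹ :=
      (monomialIdeal_ofFn _ _).symm.trans ((h ⟨((G i).2 : ℝ)⁻¹, by positivity⟩).trans
        (monomialIdeal_ofFn _ _))
    rw [h2]
    exact self_mem_weightIdeal (fun i => Ideal.Quotient.mk (Ideal.span {x}) (G i).1)
      (w := fun i => ((G i).2 : ℝ)⁻¹) i le_rfl
  -- The lift of a parameter is determined up to multiples of `x`. These are harmless: `x` has
  -- weight `1 / a`, at least the required `q / (G i).2` by `hG`.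
  obtain ⟨f, hf, r, hr⟩ := exists_mem_weightIdeal_of_mk_mem h1
  simp only [Fin.cons_succ]
  rw [hr]
  refine Ideal.add_mem _ ?_ (Ideal.mul_mem_right _ _ (weightIdeal_anti _ _ ?_ hx))
  · have h3 : f ∈ weightIdeal (fun i => (F i).1) (fun i => (((F i).2 / (q : ℚ) : ℚ) : ℝ)⁻¹)
        (((G i).2 / (q : ℚ) : ℚ) : ℝ)⁻¹ := by
      refine Ideal.span_mono ?_ hf
      rintro _ ⟨m, hm, rfl⟩
      refine ⟨m, ?_, rfl⟩
      have e (b : ℚ) : ((b / (q : ℚ) : ℚ) : ℝ)⁻¹ = (b : ℝ)⁻¹ * q := by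
        push_cast
        rw [inv_div, div_eq_inv_mul]
      simp only [e, ← smul_mul_assoc, ← Finset.sum_mul]
      exact mul_le_mul_of_nonneg_right hm hq'.le
    exact weightIdeal_tail_le _ _ _ h3
  · push_cast
    rw [inv_div, div_le_iff₀ hpos, inv_mul_eq_div, le_div_iff₀ ha']
    linarith

end Presentations

/-! ### The lexicographic invariant -/

section Invariant

variable {O : Type*} {R : Type*}

theorem ofLex_inv_apply (J : Presentation O) (i : ℕ) : ofLex (inv J) i =
    ((J.map Prod.snd)[i]?).elim ⊤ fun b => (b : WithTop ℚ) := by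
  simp only [inv, ofLex_toLex, List.getElem?_map]
  cases J[i]? <;> rfl

theorem inv_eq_of_map_snd_eq {J : Presentation O} {J' : Presentation R}
    (h : J.map Prod.snd = J'.map Prod.snd) : inv J = inv J' := by
  refine funext fun i => ?_
  change ofLex (inv J) i = ofLex (inv J') i
  rw [ofLex_inv_apply, ofLex_inv_apply, h]

theorem inv_map (f : O × ℚ → R × ℚ) (g : ℚ → ℚ) (hf : ∀ y, (f y).2 = g y.2) (L : Presentation O) :
    inv (L.map f) = toLex fun i => (ofLex (inv L) i).map g := by
  simp only [inv]
  congr 1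
  ext i
  simp only [List.getElem?_map, ofLex_toLex]
  cases L[i]? <;> simp [hf]

theorem inv_cons_zero (y : O × ℚ) (L : Presentation O) :
    ofLex (inv (y :: L)) 0 = (y.2 : WithTop ℚ) := rfl

theorem inv_cons_succ (y : O × ℚ) (L : Presentation O) (i : ℕ) :
    ofLex (inv (y :: L)) (i + 1) = ofLex (inv L) i := rfl

theorem inv_cons_lt_of_lt {y : O × ℚ} {y' : R × ℚ} (h : y.2 < y'.2) (L : Presentation O)
    (L' : Presentation R) : inv (y :: L) < inv (y' :: L') :=
  ⟨0, fun j hj => absurd hj (Nat.not_lt_zero j), by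
    change ofLex (inv (y :: L)) 0 < ofLex (inv (y' :: L')) 0
    rw [inv_cons_zero, inv_cons_zero]
    exact_mod_cast h⟩

theorem inv_le_nil {R : Type*} (J : Presentation O) : inv J ≤ inv ([] : Presentation R) :=
  Pi.toLex_monotone fun _ => le_top

theorem eq_nil_of_inv_eq {J : Presentation O} (h : inv J = inv ([] : Presentation R)) : J = [] := by
  cases J with
  | nil => rfl
  | cons y L =>
    have : (y.2 : WithTop ℚ) = ⊤ := congr_fun h 0
    exact absurd this (WithTop.coe_ne_top)

/-- Passing from the invariant on a hypersurface to the invariant on the ambient space is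
strictly monotone. -/
theorem inv_cons_map_le_iff {y : O × ℚ} {y' : R × ℚ} (h : y.2 = y'.2) {q : ℚ} (hq : 0 < q)
    {L : Presentation O} {L' : Presentation R} {f : O × ℚ → O × ℚ} {f' : R × ℚ → R × ℚ}
    (hf : ∀ y, (f y).2 = y.2 / q) (hf' : ∀ y, (f' y).2 = y.2 / q) :
    (inv L ≤ inv L' → inv (y :: L.map f) ≤ inv (y' :: L'.map f')) ∧
      (inv (y :: L.map f) = inv (y' :: L'.map f') → inv L = inv L') := by
  have e1 (i : ℕ) : ofLex (inv (y :: L.map f)) (i + 1) = (ofLex (inv L) i).map (· / q) := by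
    rw [inv_cons_succ, inv_map f (· / q) hf]; rfl
  have e2 (i : ℕ) : ofLex (inv (y' :: L'.map f')) (i + 1) = (ofLex (inv L') i).map (· / q) := by
    rw [inv_cons_succ, inv_map f' (· / q) hf']; rfl
  have hinj : Function.Injective (WithTop.map (· / q) : WithTop ℚ → WithTop ℚ) :=
    WithTop.map_injective fun a b hab => (div_left_inj' hq.ne').1 hab
  have hmono : StrictMono (WithTop.map (· / q) : WithTop ℚ → WithTop ℚ) :=
    WithTop.strictMono_map_iff.2 fun a b hab => div_lt_div_of_pos_right hab hq
  have heq (h' : inv L = inv L') : inv (y :: L.map f) = inv (y' :: L'.map f') := by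
    refine funext fun i => ?_
    change ofLex (inv (y :: L.map f)) i = ofLex (inv (y' :: L'.map f')) i
    cases i with
    | zero => rw [inv_cons_zero, inv_cons_zero, h]
    | succ i => rw [e1, e2, h']
  refine ⟨fun hle => ?_, fun heq => ?_⟩
  · rcases hle.eq_or_lt with h' | ⟨i, hi, hlt⟩
    · exact (heq h').le
    · refine le_of_lt ⟨i + 1, fun j hj => ?_, ?_⟩
      · change ofLex (inv (y :: L.map f)) j = ofLex (inv (y' :: L'.map f')) j
        cases j with
        | zero => rw [inv_cons_zero, inv_cons_zero, h]
        | succ j =>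
          rw [e1, e2]
          exact congr_arg _ (hi j (Nat.lt_of_succ_lt_succ hj))
      · change ofLex (inv (y :: L.map f)) (i + 1) < ofLex (inv (y' :: L'.map f')) (i + 1)
        rw [e1, e2]
        exact hmono hlt
  · refine funext fun i => hinj ?_
    change (ofLex (inv L) i).map (· / q) = (ofLex (inv L') i).map (· / q)
    rw [← e1, ← e2, heq]

end Invariant

/-! ### Maximality and existence of the associated center -/

section Main

open IsLocalRing

/-- `J` is an admissible center for `I`, of maximal invariant, and it is unique as such. -/
structure IsMaximalCenter {O : Type v} [CommRing O] [IsLocalRing O] (I : Ideal O)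
    (J : Presentation O) : Prop where
  isCenter : IsCenter J
  isAdmissible : IsAdmissible J I
  le_exponent : ∀ n : ℕ, I ≤ maximalIdeal O ^ n → ∀ y ∈ J, (n : ℚ) ≤ y.2
  inv_le : ∀ J' : Presentation O, IsCenter J' → IsAdmissible J' I → inv J' ≤ inv J
  monomialIdeal_eq : ∀ J' : Presentation O, IsCenter J' → IsAdmissible J' I → inv J' = inv J →
    ∀ c, monomialIdeal J' c = monomialIdeal J c

variable {k : Type u} [Field k] {O : Type v} [CommRing O] [Algebra k O]

theorem isCenter_nil [IsLocalRing O] : IsCenter ([] : Presentation O) :=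
  ⟨fun i => i.elim0, fun i => i.elim0, fun i => i.elim0,
    linearIndependent_empty_type (ι := Fin 0)⟩

theorem isAdmissible_bot (J : Presentation O) : IsAdmissible J ⊥ := by
  rintro f hf
  rw [Ideal.mem_bot.1 hf]
  exact le_iSup₂_of_le (f := fun (c : ℝ≥0) (_ : (0 : O) ∈ monomialIdeal J c) => (c : ℝ≥0∞)) 1
    (Ideal.zero_mem _) (by simp)

theorem isMaximalCenter_bot [IsLocalRing O] : IsMaximalCenter (⊥ : Ideal O) [] where
  isCenter := isCenter_nil
  isAdmissible := isAdmissible_bot _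
  le_exponent := by simp
  inv_le J' _ _ := inv_le_nil J'
  monomialIdeal_eq J' _ _ h c := by rw [eq_nil_of_inv_eq h]

theorem eq_bot_of_isAdmissible_nil {I : Ideal O} (h : IsAdmissible ([] : Presentation O) I) :
    I = ⊥ := by
  have h1 : IsAdmissible (List.ofFn (Fin.elim0 : Fin 0 → O × ℚ)) I := by simpa using h
  rw [isAdmissible_ofFn_iff (p := Fin.elim0) one_pos (fun i => i.elim0)] at h1
  refine le_bot_iff.1 (h1.trans (Ideal.span_le.2 ?_))
  rintro _ ⟨m, hm, -⟩
  simp at hm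

theorem derivIdeal_bot (n : ℕ) : derivIdeal k n (⊥ : Ideal O) = ⊥ := by
  refine le_bot_iff.1 (Ideal.span_le.2 ?_)
  rintro _ ⟨D, -, f, hf, rfl⟩
  rw [Ideal.mem_bot.1 hf]
  simp

namespace IsMaximalContact

variable {I : Ideal O} {a : ℕ} {x : O} [IsLocalRing O]

theorem ne_bot (hx : IsMaximalContact k I a x) : I ≠ ⊥ := by
  rintro rfl
  have := (order_eq_iff.1 hx.order_eq).1
  rw [derivIdeal_bot] at this
  exact bot_ne_top this

/-- All exponents are at least the first one, so a monomial of value at least 1 has degree at least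
`(F 0).2`. If this exceeded `a`, then `I ⊆ 𝔪^(a+1)`, contradicting the order. -/
theorem first_exponent_le (hx : IsMaximalContact k I a x) {n : ℕ} {F : Fin (n + 1) → O × ℚ}
    (hF : IsCenter (List.ofFn F)) (hI : IsAdmissible (List.ofFn F) I) : (F 0).2 ≤ a := by
  obtain ⟨hpos, hmono, hz⟩ := isCenter_ofFn.1 hF
  obtain ⟨D, p, hD, hp⟩ := exists_common_multiple (fun i => (F i).2) hpos
  rw [isAdmissible_ofFn_iff hD fun i => (hp i).2] at hI
  by_contra! hlt
  have h1 : I ≤ maximalIdeal O ^ (a + 1) := by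
    refine hI.trans (Ideal.span_le.2 ?_)
    rintro _ ⟨m, hm, rfl⟩
    have h2 : a < ∑ i, m i := by
      by_contra! hle
      have h3 : (D : ℚ) ≤ ∑ i, (m i : ℚ) * p i := by exact_mod_cast hm
      have h4 : (D : ℚ) * (F 0).2 ≤ ∑ i, (m i : ℚ) * D := by
        refine (mul_le_mul_of_nonneg_right h3 (hpos 0).le).trans ?_
        rw [Finset.sum_mul]
        refine Finset.sum_le_sum fun i _ => ?_
        rw [← (hp i).2, mul_assoc]
        have := hmono (Fin.zero_le i)
        simp only at this
        gcongr
      rw [← Finset.sum_mul, mul_comm] at h4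
      have h5 : (F 0).2 ≤ ∑ i, (m i : ℚ) := le_of_mul_le_mul_right h4 (by exact_mod_cast hD)
      have h6 : (∑ i, (m i : ℚ)) ≤ a := by exact_mod_cast hle
      linarith
    refine Ideal.pow_le_pow_right (Nat.succ_le_of_lt h2) ?_
    rw [← Finset.prod_pow_eq_pow_sum Finset.univ]
    exact Ideal.prod_mem_prod fun i _ => Ideal.pow_mem_pow (hz.mem i) _
  have := not_le_pow_of_derivIdeal_eq_top (order_eq_iff.1 hx.order_eq).1 h1
  omega

/-- The descent to `V(x)`: a competing center with first exponent `a` can be rewritten with `x` as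
its first parameter, without changing its monomial ideals, and then restricted. -/
theorem exists_restriction (hx : IsMaximalContact k I a x) {n : ℕ} {F : Fin (n + 1) → O × ℚ}
    (hF : IsCenter (List.ofFn F)) (hI : IsAdmissible (List.ofFn F) I) (ha : (F 0).2 = a) :
    ∃ y : Fin n → O, IsPartialParameters (Fin.cons x y : Fin (n + 1) → O) ∧
      (∀ c, monomialIdeal ((x, (a : ℚ)) :: List.ofFn fun i => (y i, (F i.succ).2)) c =
        monomialIdeal (List.ofFn F) c) ∧
      IsAdmissible (List.ofFn fun i => (Ideal.Quotient.mk (Ideal.span {x}) (y i),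
        (F i.succ).2 * ((a - 1).factorial : ℚ))) (restrictedCoeffIdeal k I a x) := by
  obtain ⟨hpos, hmono, hz⟩ := isCenter_ofFn.1 hF
  obtain ⟨D, p, hD, hp⟩ := exists_common_multiple (fun i => (F i).2) hpos
  have hI' := (isAdmissible_ofFn_iff hD fun i => (hp i).2).1 hI
  have hDa : D = a * p 0 := by
    have := (hp 0).2
    rw [ha, mul_comm] at this
    exact_mod_cast this.symm
  have hp₀ (i) : p i ≤ p 0 := by
    have h1 : (p i : ℚ) * (F 0).2 ≤ (p 0 : ℚ) * (F 0).2 := by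
      rw [(hp 0).2, ← (hp i).2]
      exact mul_le_mul_of_nonneg_left (hmono (Fin.zero_le i)) (Nat.cast_nonneg _)
    exact_mod_cast le_of_mul_le_mul_right h1 (hpos 0)
  -- Because `x ∈ 𝒟^{a-1}(I)` and `D = a * p 0`, at least `D - (a - 1) * p 0 = p 0` of the weight
  -- survives.
  have hxp : x ∈ weightIdeal (fun i => (F i).1) p (p 0) := by
    have h1 := derivIdeal_le_weightIdeal (fun i => (hp i).1) hp₀ hI' hx.mem
    have h2 : D - (a - 1) * p 0 = p 0 := by
      obtain ⟨b, rfl⟩ : ∃ b, a = b + 1 := ⟨a - 1, by have := hx.pos; omega⟩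
      rw [hDa, Nat.add_sub_cancel, Nat.succ_mul, Nat.add_sub_cancel_left]
    rwa [h2] at h1
  obtain ⟨y, hy, hyw⟩ := hz.exists_replacement (hp 0).1 hp₀ hx.mem_maximalIdeal hx.notMem_sq hxp
  refine ⟨y, hy, fun c => ?_, ?_⟩
  · have e : ((x, (a : ℚ)) :: List.ofFn fun i => (y i, (F i.succ).2)) = List.ofFn fun i =>
        ((Fin.cons x y : Fin (n + 1) → O) i, (F i).2) := by
      rw [List.ofFn_succ]
      simp [ha]
    rw [e, monomialIdeal_ofFn_eq_weightIdeal (F := F) hD fun i => (hp i).2, ← hyw]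
    exact monomialIdeal_ofFn_eq_weightIdeal
      (F := fun i => ((Fin.cons x y : Fin (n + 1) → O) i, (F i).2)) hD (fun i => (hp i).2) c
  · have hD' : 0 < a.factorial * p 0 := Nat.mul_pos (Nat.factorial_pos a) (hp 0).1
    refine (isAdmissible_ofFn_iff (p := fun i => p i.succ) hD' fun i => ?_).2 ?_
    · simp only
      rw [← mul_assoc, (hp i.succ).2, hDa, ← Nat.mul_factorial_pred hx.pos.ne']
      push_cast
      ring
    · refine restrictedCoeffIdeal_le_weightIdeal (z := Fin.cons x y) (fun i => (hp i).1) hp₀ ?_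
      rw [hyw, ← hDa]
      exact hI'

variable [CharZero k]

theorem isMaximalCenter (hx : IsMaximalContact k I a x) (hO : HasEnoughDerivations k O)
    [IsLocalRing (O ⧸ Ideal.span {x})] {n : ℕ} {G : Fin n → O × ℚ}
    (hG : IsMaximalCenter (restrictedCoeffIdeal k I a x)
      (List.ofFn fun i => (Ideal.Quotient.mk (Ideal.span {x}) (G i).1, (G i).2))) :
    IsMaximalCenter I ((x, (a : ℚ)) ::
      List.ofFn fun i => ((G i).1, (G i).2 / ((a - 1).factorial : ℚ))) := by
  have hq : 0 < (a - 1).factorial := Nat.factorial_pos _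
  have hq' : (0 : ℚ) < (a - 1).factorial := by exact_mod_cast hq
  have hapos : (0 : ℚ) < a := by exact_mod_cast hx.pos
  have hfac : (a.factorial : ℚ) = a * (a - 1).factorial := by
    exact_mod_cast (Nat.mul_factorial_pred hx.pos.ne').symm
  obtain ⟨hpos, hmono, hz⟩ := isCenter_ofFn.1 hG.isCenter
  have hcoeff : restrictedCoeffIdeal k I a x ≤
      maximalIdeal (O ⧸ Ideal.span {x}) ^ a.factorial := by
    rw [← map_mk_maximalIdeal, ← Ideal.map_pow]
    exact Ideal.map_mono (hx.coeffIdeal_le hO)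
  -- This is what the field `le_exponent` is carried through the induction for: it makes the
  -- exponents of the new center nondecreasing.
  have hexp (i) : (a * (a - 1).factorial : ℚ) ≤ (G i).2 := by
    rw [← hfac]
    exact hG.le_exponent _ hcoeff _ (List.mem_ofFn.2 ⟨i, rfl⟩)
  have hexp' (i) : (a : ℚ) ≤ (G i).2 / ((a - 1).factorial : ℚ) := (le_div_iff₀ hq').2 (hexp i)
  have hpar := IsPartialParameters.cons_of_quotient hx.mem_maximalIdeal hx.notMem_sq hz
  have hcons : ((x, (a : ℚ)) :: List.ofFn fun i => ((G i).1, (G i).2 / ((a - 1).factorial : ℚ))) =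
      List.ofFn fun i => ((Fin.cons x fun i => (G i).1 : Fin (n + 1) → O) i,
        (Fin.cons (a : ℚ) fun i => (G i).2 / ((a - 1).factorial : ℚ) : Fin (n + 1) → ℚ) i) := by
    rw [List.ofFn_succ]
    simp
  have hmain (J' : Presentation O) (h1 : IsCenter J') (h2 : IsAdmissible J' I) :
      inv J' ≤ inv ((x, (a : ℚ)) :: List.ofFn fun i =>
        ((G i).1, (G i).2 / ((a - 1).factorial : ℚ))) ∧
      (inv J' = inv ((x, (a : ℚ)) :: List.ofFn fun i =>
        ((G i).1, (G i).2 / ((a - 1).factorial : ℚ))) →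
      ∀ c, monomialIdeal J' c = monomialIdeal ((x, (a : ℚ)) :: List.ofFn fun i =>
        ((G i).1, (G i).2 / ((a - 1).factorial : ℚ))) c) := by
    obtain ⟨m, F, rfl⟩ : ∃ (m : ℕ) (F : Fin m → O × ℚ), J' = List.ofFn F :=
      ⟨J'.length, J'.get, (List.ofFn_get J').symm⟩
    -- The empty center is admissible only for the zero ideal, and `I` has finite order.
    obtain _ | m := m
    · rw [List.ofFn_zero] at h2
      exact absurd (eq_bot_of_isAdmissible_nil h2) hx.ne_bot
    rcases (hx.first_exponent_le h1 h2).lt_or_eq with hlt | heq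
    · have := inv_cons_lt_of_lt (y := F 0) (y' := (x, (a : ℚ))) hlt (List.ofFn fun i => F i.succ)
        (List.ofFn fun i => ((G i).1, (G i).2 / ((a - 1).factorial : ℚ)))
      rw [← List.ofFn_succ] at this
      exact ⟨this.le, fun h => absurd h this.ne⟩
    obtain ⟨y, hy, hyc, hya⟩ := hx.exists_restriction h1 h2 heq
    obtain ⟨hFpos, hFmono, -⟩ := isCenter_ofFn.1 h1
    have hFa (i : Fin m) : (a : ℚ) ≤ (F i.succ).2 := heq ▸ hFmono (Fin.zero_le i.succ)
    have hcen : IsCenter (List.ofFn fun i : Fin m => (Ideal.Quotient.mk (Ideal.span {x}) (y i),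
        (F i.succ).2 * ((a - 1).factorial : ℚ))) := by
      refine isCenter_ofFn.2 ⟨fun i => mul_pos (hFpos _) hq', fun i j hij => ?_, hy.quotient⟩
      exact mul_le_mul_of_nonneg_right (hFmono (Fin.succ_le_succ_iff.2 hij)) hq'.le
    have hinv := inv_cons_map_le_iff (y := F 0) (y' := (x, (a : ℚ))) heq hq'
      (L := List.ofFn fun i : Fin m => ((F i.succ).1, (F i.succ).2 * ((a - 1).factorial : ℚ)))
      (L' := List.ofFn G) (f := fun y => (y.1, y.2 / ((a - 1).factorial : ℚ)))
      (f' := fun y => (y.1, y.2 / ((a - 1).factorial : ℚ))) (fun _ => rfl) (fun _ => rfl)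
    -- The tail of the competitor is written as its rescaling by `(a - 1)!` divided by `(a - 1)!`,
    -- the form in which `inv_cons_map_le_iff` compares it with the center on `V(x)`.
    have e1 : F 0 :: (List.ofFn fun i : Fin m => ((F i.succ).1,
        (F i.succ).2 * ((a - 1).factorial : ℚ))).map
          (fun y => (y.1, y.2 / ((a - 1).factorial : ℚ))) = List.ofFn F := by
      rw [List.ofFn_succ (f := F), List.map_ofFn]
      simp [Function.comp_def, mul_div_cancel_right₀ _ hq'.ne']
    have e2 : (List.ofFn G).map (fun y => (y.1, y.2 / ((a - 1).factorial : ℚ))) =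
        List.ofFn fun i => ((G i).1, (G i).2 / ((a - 1).factorial : ℚ)) := List.map_ofFn ..
    have e3 : inv (List.ofFn fun i : Fin m => (Ideal.Quotient.mk (Ideal.span {x}) (y i),
        (F i.succ).2 * ((a - 1).factorial : ℚ))) =
        inv (List.ofFn fun i : Fin m =>
          ((F i.succ).1, (F i.succ).2 * ((a - 1).factorial : ℚ))) := by
      exact inv_eq_of_map_snd_eq (by simp [List.map_ofFn, Function.comp_def])
    have e4 : inv (List.ofFn fun i => (Ideal.Quotient.mk (Ideal.span {x}) (G i).1, (G i).2)) =
        inv (List.ofFn G) :=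
      inv_eq_of_map_snd_eq (by simp [List.map_ofFn, Function.comp_def])
    rw [e1, e2, ← e3, ← e4] at hinv
    refine ⟨hinv.1 (hG.inv_le _ hcen hya), fun h c => ?_⟩
    have hmon := hG.monomialIdeal_eq _ hcen hya (hinv.2 h)
    have e5 : (fun i : Fin m => (y i, (F i.succ).2)) = fun i => (y i,
        (F i.succ).2 * ((a - 1).factorial : ℚ) / ((a - 1).factorial : ℚ)) := by
      simp [mul_div_cancel_right₀ _ hq'.ne']
    rw [← hyc, e5]
    refine le_antisymm ?_ ?_
    · exact monomialIdeal_cons_le hx.pos hq (F := G)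
        (G := fun i : Fin m => (y i, (F i.succ).2 * ((a - 1).factorial : ℚ)))
        (fun i => mul_le_mul_of_nonneg_right (hFa i) hq'.le) (fun c => (hmon c).symm) c
    · exact monomialIdeal_cons_le hx.pos hq
        (F := fun i : Fin m => (y i, (F i.succ).2 * ((a - 1).factorial : ℚ))) (G := G) hexp hmon c
  refine ⟨?_, ?_, ?_, fun J' h1 h2 => (hmain J' h1 h2).1, fun J' h1 h2 => (hmain J' h1 h2).2⟩
  · rw [hcons, isCenter_ofFn]
    refine ⟨Fin.cases hapos fun i => div_pos (hpos i) hq', fun i j => ?_, hpar⟩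
    refine Fin.cases ?_ (fun i => ?_) i <;> refine Fin.cases ?_ (fun j => ?_) j <;> intro hij
    · exact le_rfl
    · exact hexp' j
    · exact absurd hij (not_le.2 (Fin.succ_pos i))
    · exact div_le_div_of_nonneg_right (hmono (Fin.succ_le_succ_iff.1 hij)) hq'.le
  -- Including `a!` among the exponents gives `x` the integral weight `p 0` with `D = a! * p 0`.
  -- Dividing the exponents by `(a - 1)!` replaces `D` by `a * p 0` with the same weights.
  · obtain ⟨D, p, hD, hp⟩ := exists_common_multiple
      (Fin.cons (a.factorial : ℚ) fun i => (G i).2 : Fin (n + 1) → ℚ)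
      (Fin.cases (by simp [Nat.factorial_pos]) hpos)
    have hD0 : D = a.factorial * p 0 := by
      have := (hp 0).2
      rw [Fin.cons_zero, mul_comm] at this
      exact_mod_cast this.symm
    have hps (i : Fin n) : (p i.succ : ℚ) * (G i).2 = D := by simpa using (hp i.succ).2
    have hp₀ (i : Fin n) : p i.succ ≤ p 0 := by
      have h1 : (p i.succ : ℚ) * a.factorial ≤ (p 0 : ℚ) * a.factorial := by
        have h2 : (p 0 : ℚ) * a.factorial = D := by simpa using (hp 0).2
        rw [h2, ← hps i]
        exact mul_le_mul_of_nonneg_left (hfac ▸ hexp i) (Nat.cast_nonneg _)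
      exact_mod_cast le_of_mul_le_mul_right h1 (by exact_mod_cast Nat.factorial_pos a)
    have h1 := (isAdmissible_ofFn_iff (F := fun i => (Ideal.Quotient.mk (Ideal.span {x}) (G i).1,
      (G i).2)) (p := fun i => p i.succ) hD hps).1 hG.isAdmissible
    rw [hD0] at h1
    have h2 := hx.le_weightIdeal hO hpar (fun i => (hp i.succ).1) hp₀ (hp 0).1 h1
    rw [hcons]
    refine (isAdmissible_ofFn_iff (p := Fin.cons (p 0) fun i => p i.succ)
      (Nat.mul_pos hx.pos (hp 0).1) (Fin.cases ?_ fun i => ?_)).2 h2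
    · simp [mul_comm]
    · simp only [Fin.cons_succ]
      rw [← mul_div_assoc, hps i, hD0, div_eq_iff hq'.ne']
      push_cast
      rw [hfac]
      ring
  · intro N hN y hy
    have hNa : (N : ℚ) ≤ a := by
      exact_mod_cast not_le_pow_of_derivIdeal_eq_top (order_eq_iff.1 hx.order_eq).1 hN
    rcases List.mem_cons.1 hy with rfl | hy
    · exact hNa
    · obtain ⟨i, rfl⟩ := List.mem_ofFn.1 hy
      exact hNa.trans (hexp' i)

end IsMaximalContact

variable [CharZero k]

theorem IsAssociatedCenter.isMaximalCenter {I : Ideal O} {J : Presentation O}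
    (h : IsAssociatedCenter k I J) :
    ∀ [IsLocalRing O], HasEnoughDerivations k O → IsMaximalCenter I J := by
  induction h with
  | zero => exact fun _ => isMaximalCenter_bot
  | step I a x hx L hL ih =>
    intro _ hO
    have := isLocalRing_quotient ((Ideal.span_singleton_le_iff_mem _).2 hx.mem_maximalIdeal)
    have hG := ih (hO.quotient_span_singleton hx.mem_maximalIdeal hx.notMem_sq)
    obtain ⟨n, G, rfl⟩ : ∃ (n : ℕ) (G : Fin n → _ × ℚ), L = List.ofFn G :=
      ⟨L.length, L.get, (List.ofFn_get L).symm⟩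
    rw [List.map_ofFn] at hG ⊢
    exact hx.isMaximalCenter hO hG

/-- A unit coefficient in an expression of `x` makes that generator superfluous modulo `x`. The drop
in the number of generators is what makes the construction terminate. -/
theorem exists_generators_quotient [IsLocalRing O] {n : ℕ} {z : Fin (n + 1) → O}
    (hz : Ideal.span (Set.range z) = maximalIdeal O) {x : O} (hx : x ∈ maximalIdeal O)
    (hx2 : x ∉ maximalIdeal O ^ 2) [IsLocalRing (O ⧸ Ideal.span {x})] :
    ∃ y : Fin n → O ⧸ Ideal.span {x},
      Ideal.span (Set.range y) = maximalIdeal (O ⧸ Ideal.span {x}) := by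
  have hzm (i) : z i ∈ maximalIdeal O := hz ▸ Ideal.subset_span (Set.mem_range_self i)
  obtain ⟨c, hc⟩ := Ideal.mem_span_range_iff_exists_fun.1 (hz ▸ hx)
  obtain ⟨i, hi⟩ : ∃ i, c i ∉ maximalIdeal O := by
    by_contra! h
    refine hx2 ?_
    rw [← hc, pow_two]
    exact Ideal.sum_mem _ fun i _ => Ideal.mul_mem_mul (h i) (hzm i)
  obtain ⟨u, hu⟩ := notMem_maximalIdeal.1 hi
  let φ := Ideal.Quotient.mk (Ideal.span {x})
  refine ⟨fun j => φ (z (i.succAbove j)), le_antisymm (Ideal.span_le.2 ?_) ?_⟩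
  · rintro _ ⟨j, rfl⟩
    exact mk_mem_maximalIdeal_iff.2 (hzm _)
  rw [← map_mk_maximalIdeal, ← hz, Ideal.map_span]
  refine Ideal.span_le.2 ?_
  rintro _ ⟨_, ⟨j, rfl⟩, rfl⟩
  have hmem (j : Fin n) : φ (z (i.succAbove j)) ∈
      Ideal.span (Set.range fun j => φ (z (i.succAbove j))) :=
    Ideal.subset_span (Set.mem_range_self j)
  rcases Fin.eq_self_or_eq_succAbove i j with rfl | ⟨j, rfl⟩
  · have e : z j = (↑u⁻¹ : O) * x - (↑u⁻¹ : O) * ∑ l, c (j.succAbove l) * z (j.succAbove l) := by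
      rw [← hc, Fin.sum_univ_succAbove _ j, ← hu, mul_add, Units.inv_mul_cancel_left,
        add_sub_cancel_right]
    have hφx : φ x = 0 := Ideal.Quotient.eq_zero_iff_mem.2 (Ideal.mem_span_singleton_self x)
    change φ (z j) ∈ _
    rw [e, map_sub, map_mul, hφx, mul_zero, zero_sub, map_mul, map_sum]
    refine neg_mem (Ideal.mul_mem_left _ _ (Ideal.sum_mem _ fun l _ => ?_))
    rw [map_mul]
    exact Ideal.mul_mem_left _ _ (hmem l)
  · exact hmem j

theorem exists_isAssociatedCenter (n : ℕ) : ∀ {O : Type v} [CommRing O] [Algebra k O]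
    [IsLocalRing O], HasEnoughDerivations k O → ∀ {z : Fin n → O},
      Ideal.span (Set.range z) = maximalIdeal O → ∀ {I : Ideal O}, I ≤ maximalIdeal O →
        ∃ J, IsAssociatedCenter k I J := by
  induction n with
  | zero =>
    intro O _ _ _ hO z hz I hI
    have : I = ⊥ := by
      rw [← hz, Set.range_eq_empty, Ideal.span_empty] at hI
      exact le_bot_iff.1 hI
    exact ⟨[], this ▸ .zero⟩
  | succ n ih =>
    intro O _ _ _ hO z hz I hI
    by_cases h0 : I = ⊥
    · exact ⟨[], h0 ▸ .zero⟩
    obtain ⟨a, ha, ho⟩ := hO.exists_order_eq hI h0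
    obtain ⟨x, hx⟩ := hO.exists_isMaximalContact ha ho
    have := isLocalRing_quotient ((Ideal.span_singleton_le_iff_mem _).2 hx.mem_maximalIdeal)
    obtain ⟨y, hy⟩ := exists_generators_quotient hz hx.mem_maximalIdeal hx.notMem_sq
    obtain ⟨L, hL⟩ := ih (hO.quotient_span_singleton hx.mem_maximalIdeal hx.notMem_sq) hy
      (I := restrictedCoeffIdeal k I a x) (by
        rw [← map_mk_maximalIdeal]
        exact Ideal.map_mono ((hx.coeffIdeal_le hO).trans
          (Ideal.pow_le_self (Nat.factorial_ne_zero a))))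
    -- Any lifts of the parameters on `V(x)` will do.
    obtain ⟨L, rfl⟩ : ∃ L' : Presentation O,
        L = L'.map fun y => (Ideal.Quotient.mk (Ideal.span {x}) y.1, y.2) := by
      refine ⟨L.map fun y => (Function.surjInv Ideal.Quotient.mk_surjective y.1, y.2), ?_⟩
      simp [Function.comp_def, Function.surjInv_eq]
    exact ⟨_, .step I a x hx L hL⟩

end Main

/-! ### Derivations on smooth local rings -/

section Smooth

open IsLocalRing TensorProduct

/-- In characteristic 0 the residue field `κ` is formally smooth over `k`, so `𝔪/𝔪² → κ ⊗ Ω` is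
split injective and `1 ⊗ dx ≠ 0` for `x ∉ 𝔪²`. A functional not vanishing on it lifts to `Ω → O`, as
`Ω` is projective, and the lift is the required derivation. -/
theorem hasEnoughDerivations_of_formallySmooth {k O : Type*} [Field k] [CharZero k] [CommRing O]
    [Algebra k O] [IsLocalRing O] [Algebra.FormallySmooth k O] [Algebra.EssFiniteType k O] :
    HasEnoughDerivations k O := by
  refine ⟨Algebra.EssFiniteType.isNoetherianRing k O, fun x hx hx2 => ?_⟩
  have : Algebra.EssFiniteType k (ResidueField O) := Algebra.EssFiniteType.comp k O _
  have hs : Algebra.FormallySmooth k (ResidueField O) := inferInstance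
  rw [Algebra.FormallySmooth.iff_split_injection (P := O) residue_surjective] at hs
  obtain ⟨l, hl⟩ := hs
  have hker : RingHom.ker (algebraMap O (ResidueField O)) = maximalIdeal O := ker_residue
  let x' : RingHom.ker (algebraMap O (ResidueField O)) := ⟨x, hker ▸ hx⟩
  have h0 : (1 : ResidueField O) ⊗ₜ[O] KaehlerDifferential.D k O x ≠ 0 := by
    intro h
    have h1 := LinearMap.congr_fun hl (Ideal.toCotangent _ x')
    rw [LinearMap.comp_apply, KaehlerDifferential.kerCotangentToTensor_toCotangent] at h1
    have h2 : Ideal.toCotangent _ x' = 0 := by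
      rw [← LinearMap.id_apply (R := O) (Ideal.toCotangent _ x'), ← h1]
      change l ((1 : ResidueField O) ⊗ₜ[O] KaehlerDifferential.D k O x) = 0
      rw [h, map_zero]
    rw [Ideal.toCotangent_eq_zero] at h2
    exact hx2 (hker ▸ (show x ∈ RingHom.ker (algebraMap O (ResidueField O)) ^ 2 from h2))
  obtain ⟨φ, hφ⟩ : ∃ φ : Module.Dual (ResidueField O) (ResidueField O ⊗[O] Ω[O⁄k]),
      φ ((1 : ResidueField O) ⊗ₜ[O] KaehlerDifferential.D k O x) ≠ 0 := by
    by_contra! h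
    exact h0 ((Module.forall_dual_apply_eq_zero_iff _ _).1 h)
  obtain ⟨h, hh⟩ := Module.projective_lifting_property (Algebra.linearMap O (ResidueField O))
    ((φ.restrictScalars O) ∘ₗ (TensorProduct.mk O (ResidueField O) Ω[O⁄k] 1)) residue_surjective
  refine ⟨h.compDer (KaehlerDifferential.D k O), ?_⟩
  rw [← residue_ne_zero_iff_isUnit]
  have := LinearMap.congr_fun hh (KaehlerDifferential.D k O x)
  intro h3
  refine hφ (this.symm.trans h3)

end Smooth

/-! ### Stalks of the ideal sheaf and conclusion -/

section Stalk

open IsLocalRing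

variable {k : Type u} [Field k] {Y : Scheme.{u}}

theorem stalkIdeal_le_maximalIdeal (π : Y ⟶ Spec (CommRingCat.of k)) {p : Y}
    {I : Y.IdealSheafData} (hp : p ∈ I.support) :
    stalkIdeal π p I ≤ maximalIdeal (LocalRing π p) := by
  refine iSup₂_le fun U h => Ideal.map_le_iff_le_comap.2 fun f hf => ?_
  have h1 := (Scheme.IdealSheafData.mem_support_iff_of_mem h).1 hp
  rw [Scheme.mem_zeroLocus_iff] at h1
  have h2 := h1 f hf
  rw [Scheme.mem_basicOpen _ _ _ h] at h2
  exact h2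

end Stalk

end WeightedCenter

end

theorem mainTheorem7 {k : Type u} [Field k] [CharZero k]
    {Y : Scheme.{u}} (π : Y ⟶ Spec (CommRingCat.of k)) [Smooth π]
    (I : Y.IdealSheafData) (p : Y) (hp : p ∈ I.support) :
    -- the construction has an outcome
    (∃ J : WeightedCenter.Presentation (WeightedCenter.LocalRing π p),
      WeightedCenter.IsAssociatedCenter k (WeightedCenter.stalkIdeal π p I) J) ∧
    -- each outcome is a center, is admissible, and is the unique one of maximal invariant
    (∀ J : WeightedCenter.Presentation (WeightedCenter.LocalRing π p),
      WeightedCenter.IsAssociatedCenter k (WeightedCenter.stalkIdeal π p I) J →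
        WeightedCenter.IsCenter J ∧
        WeightedCenter.IsAdmissible J (WeightedCenter.stalkIdeal π p I) ∧
        ∀ J' : WeightedCenter.Presentation (WeightedCenter.LocalRing π p),
          WeightedCenter.IsCenter J' →
          WeightedCenter.IsAdmissible J' (WeightedCenter.stalkIdeal π p I) →
            WeightedCenter.inv J' ≤ WeightedCenter.inv J ∧
            (WeightedCenter.inv J' = WeightedCenter.inv J →
              WeightedCenter.valuation J' = WeightedCenter.valuation J)) ∧
    -- the invariant and the center do not depend on the choices
    (∀ J₁ J₂ : WeightedCenter.Presentation (WeightedCenter.LocalRing π p),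
      WeightedCenter.IsAssociatedCenter k (WeightedCenter.stalkIdeal π p I) J₁ →
      WeightedCenter.IsAssociatedCenter k (WeightedCenter.stalkIdeal π p I) J₂ →
        WeightedCenter.inv J₁ = WeightedCenter.inv J₂ ∧
        WeightedCenter.valuation J₁ = WeightedCenter.valuation J₂) := by
  obtain ⟨_, _⟩ := WeightedCenter.localRing_smooth π p
  have hO : WeightedCenter.HasEnoughDerivations k (WeightedCenter.LocalRing π p) :=
    WeightedCenter.hasEnoughDerivations_of_formallySmooth
  have := hO.isNoetherianRing
  have hmax (J : WeightedCenter.Presentation (WeightedCenter.LocalRing π p))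
      (hJ : WeightedCenter.IsAssociatedCenter k (WeightedCenter.stalkIdeal π p I) J) :=
    hJ.isMaximalCenter hO
  refine ⟨?_, fun J hJ => ?_, fun J₁ J₂ h₁ h₂ => ?_⟩
  · obtain ⟨n, z, -, hz⟩ := WeightedCenter.exists_parameters (O := WeightedCenter.LocalRing π p)
    exact WeightedCenter.exists_isAssociatedCenter n hO hz
      (WeightedCenter.stalkIdeal_le_maximalIdeal π hp)
  · have h := hmax J hJ
    exact ⟨h.isCenter, h.isAdmissible, fun J' h1 h2 => ⟨h.inv_le J' h1 h2, fun h3 =>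
      WeightedCenter.valuation_congr (h.monomialIdeal_eq J' h1 h2 h3)⟩⟩
  · have h := hmax J₁ h₁
    have h' := hmax J₂ h₂
    -- Each outcome is an admissible center, hence is bounded by the maximality of the other.
    have he := le_antisymm (h'.inv_le J₁ h.isCenter h.isAdmissible)
      (h.inv_le J₂ h'.isCenter h'.isAdmissible)
    exact ⟨he, WeightedCenter.valuation_congr
      (h'.monomialIdeal_eq J₁ h.isCenter h.isAdmissible he)⟩
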